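/- All alphabets and state sets are finite. A transducer $\mathcal T$ with input alphabet $\Sigma$ and output alphabet $\Gamma$ is a nondeterministic finite automaton over $\Sigma$ (its input automaton) together with an output word in $\Gamma^*$ for every transition and a terminal output word $\tau(q)\in\Gamma^*$ for every accepting state $q$. We write $p\xrightarrow{u|v}q$ if there is a run from $p$ to $q$ on $u\in\Sigma^*$ whose transition outputs concatenate to $v$. The transducer defines the relation $[\![\mathcal T]\!]=\{(u,v\tau(q)) : p\xrightarrow{u|v}q,\ p \text{ initial},\ q\text{ accepting}\}$, whose domain is $\mathrm{dom}(\mathcal T)$. It is sequential if its input automaton has exactly one initial state and at most one transition from each state on each letter, and trim if every state is reachable from an initial state and can reach an accepting state. A relation $S\subseteq\Sigma^*\times\Gamma^*$ is sequentially realisable if there is a sequential transducer $\mathcal I$ whose domain is the domain of $S$ and with $[\![\mathcal I]\!]\subseteq S$. A transducer is multi-sequential if it is the disjoint union of finitely many sequential transducers. **Lemma.** Let $\mathcal T=\biguplus_{i=1}^n\mathcal D_i$ be a trim multi-sequential transducer, where each $\mathcal D_i$ is sequential with initial state $q_0^i$. Then $[\![\mathcal T]\!]$ is not sequentially realisable if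 and only if there exists a witness for $\mathcal T$, where a witness is a finite (non-empty, rooted) tree each of whose nodes $x$ is labelled by a triple $(u_x,v_x,S_x)\in\Sigma^*\times\Sigma^*\times(2^{\{1,\dots,n\}}\setminus\{\varnothing\})$ such that: 1. (maximality) if $x$ is the root, then $S_x=\{1,\dots,n\}$; 2. (consistency) for every node $x$, $S_x$ is the union of two disjoint sets $N_x,L_x$ such that for all $i\in N_x$ there is no run of $\mathcal D_i$ on $u_x$ from $q_0^i$, and for all $i\in L_x$ there are runs of $\mathcal D_i$ of the form $q_0^i\xrightarrow{u_x|\alpha_{x,i}}p_{x,i}\xrightarrow{v_x|\beta_{x,i}}p_{x,i}$; 3. (monotonicity) if $y$ is a child of $x$, then $S_y\subsetneq L_x$ and $u_x$ is a prefix of $u_y$; 4. (partition) if $x$ is not a leaf, then the sets $S_y$, for $y$ ranging over the children of $x$, are pairwise disjoint and their union is $L_x$; 5. (delays) if $y$ and $z$ are different children of $x$, then for all $i\in S_y$ and $j\in S_z$, either $|\beta_{x,i}|\neq|\beta_{x,j}|$, or $\beta_{x,i}\beta_{x,j}\neq\epsilon$ and $\alpha_{x,i}$ and $\alpha_{x,j}$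 mismatch, i.e. there is a position $m\le|\alpha_{x,i}|,|\alpha_{x,j}|$ at which they carry different letters; 6. (leaves) if $x$ is a leaf, then there is $w\in\Sigma^*$ such that $u_xw\in\mathrm{dom}(\mathcal T)$ and $u_xw\notin\mathrm{dom}(\mathcal D_i)$ for all $i\in S_x$. -/

import Mathlib

/-- A (real-time) transducer with input alphabet `α`, output alphabet `β` and set of states `Q`:
an automaton over `α` (the input automaton), an output word for every transition and a terminal
output word for every accepting state.  The values of `out` and `fin` are used only on
transitions and on accepting states, respectively. -/
structure Transducer (α : Type*) (β : Type*) (Q : Type*) extends NFA α Q where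
  out : Q → α → Q → List β
  fin : Q → List β

namespace Transducer

variable {α β Q : Type*}

/-- `T.Run p u v q`: there is a run of `T` from `p` to `q` on the input word `u` which produces
the output word `v`. -/
inductive Run (T : Transducer α β Q) : Q → List α → List β → Q → Prop
  | nil (q : Q) : Run T q [] [] q
  | cons {p q r : Q} {a : α} {u : List α} {v : List β} (h : q ∈ T.step p a)
      (hr : Run T q u v r) : Run T p (a :: u) (T.out p a q ++ v) r

/-- The relation defined by a transducer. -/
def rel (T : Transducer α β Q) : Set (List α × List β) :=
  {x | ∃ p ∈ T.start, ∃ q ∈ T.accept, ∃ v, T.Run p x.1 v q ∧ x.2 = v ++ T.fin q}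

/-- The input automaton is deterministic: there is exactly one initial state, and at most one
transition from each state on each letter. -/
def IsSequential (T : Transducer α β Q) : Prop :=
  (∃! q, q ∈ T.start) ∧ ∀ p a, (T.step p a).Subsingleton

/-- Every state is reachable and co-reachable. -/
def IsTrim (T : Transducer α β Q) : Prop :=
  ∀ q, (∃ p ∈ T.start, ∃ u v, T.Run p u v q) ∧ (∃ r ∈ T.accept, ∃ u v, T.Run q u v r)

/-- There is an initial run of `T` on `u`. -/
def HasInitialRun (T : Transducer α β Q) (u : List α) : Prop :=
  ∃ p ∈ T.start, ∃ v q, T.Run p u v q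

/-- The disjoint union of a family of transducers. -/
def disjUnion {ι : Type*} [DecidableEq ι] {Q : ι → Type*} (D : ∀ i, Transducer α β (Q i)) :
    Transducer α β (Σ i, Q i) where
  step p a := {q | ∃ q' ∈ (D p.1).step p.2 a, q = ⟨p.1, q'⟩}
  start := {p | p.2 ∈ (D p.1).start}
  accept := {p | p.2 ∈ (D p.1).accept}
  out p a q := if h : q.1 = p.1 then (D p.1).out p.2 a (h ▸ q.2) else []
  fin p := (D p.1).fin p.2

end Transducer

/-- The domain of a relation between words. -/
def relDom {α β : Type*} (S : Set (List α × List β)) : Set (List α) := {u | ∃ v, (u, v) ∈ S}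

/-- The specification `S` is realisable by a sequential transducer `I`: `I` has the same domain as
`S` and `(u, I(u)) ∈ S` for all `u` in this domain (`I` defines a partial function). -/
def SequentiallyRealisable {α β : Type*} (S : Set (List α × List β)) : Prop :=
  ∃ (P : Type) (_ : Finite P) (I : Transducer α β P),
    I.IsSequential ∧ relDom I.rel = relDom S ∧ ∀ u v, (u, v) ∈ I.rel → (u, v) ∈ S

/-- Two words mismatch if they carry different letters at some common position. -/
def Mismatch {β : Type*} (v w : List β) : Prop :=
  ∃ (m : ℕ) (hv : m < v.length) (hw : m < w.length), v[m] ≠ w[m]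

/-- Labels `(u, v, S)` of the nodes of a witness. -/
structure WitnessLabel (n : ℕ) (α : Type*) where
  u : List α
  v : List α
  S : Finset (Fin n)
  nonempty : S.Nonempty

/-- Finite (rooted, non-empty) trees whose nodes carry witness labels. -/
inductive WitnessTree (n : ℕ) (α : Type*)
  | node (l : WitnessLabel n α) (k : ℕ) (children : Fin k → WitnessTree n α) : WitnessTree n α

namespace WitnessTree

variable {n : ℕ} {α : Type*}

/-- The label of the root. -/
def label : WitnessTree n α → WitnessLabel n α
  | node l _ _ => l

/-- `P` holds at every node: `P l k c` is a condition on the label `l` of a node with `k` children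
and on the labels `c` of these children. -/
def AtAllNodes (P : WitnessLabel n α → (k : ℕ) → (Fin k → WitnessLabel n α) → Prop) :
    WitnessTree n α → Prop
  | node l k c => P l k (fun y => (c y).label) ∧ ∀ y, (c y).AtAllNodes P

end WitnessTree

/-- The conditions at a node labelled `x` with `k` children labelled `c`, where `N`, `L` is the
splitting of `x.S` and `a i`, `b i` are the words produced by the `i`-th transducer on `x.u`
and on the loop `x.v`, for `i ∈ L`. -/
structure WitnessNodeConditions {α β : Type*} {n : ℕ} {Q : Fin n → Type*}
    (D : ∀ i, Transducer α β (Q i)) (x : WitnessLabel n α) (k : ℕ)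
    (c : Fin k → WitnessLabel n α) (N L : Finset (Fin n)) (a b : Fin n → List β) : Prop where
  split_disjoint : Disjoint N L
  split_union : N ∪ L = x.S
  no_run : ∀ i ∈ N, ¬ (D i).HasInitialRun x.u
  loop_run : ∀ i ∈ L, ∃ q ∈ (D i).start, ∃ p, (D i).Run q x.u (a i) p ∧ (D i).Run p x.v (b i) p
  monotonicity : ∀ y, (c y).S ⊂ L ∧ x.u <+: (c y).u
  /-- For a node that is not a leaf, the sets of its children partition `L`. -/
  partition : 0 < k → (∀ y z, y ≠ z → Disjoint (c y).S (c z).S) ∧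
    Finset.univ.biUnion (fun y => (c y).S) = L
  delays : ∀ y z, y ≠ z → ∀ i ∈ (c y).S, ∀ j ∈ (c z).S,
    (b i).length ≠ (b j).length ∨ (b i ++ b j ≠ [] ∧ Mismatch (a i) (a j))
  leaves : k = 0 → ∃ w, x.u ++ w ∈ relDom (Transducer.disjUnion D).rel ∧
    ∀ i ∈ x.S, x.u ++ w ∉ relDom (D i).rel

/-- The tree `t` is a witness for the disjoint union of the transducers `D i`. -/
def IsWitness {α β : Type*} {n : ℕ} {Q : Fin n → Type*} (D : ∀ i, Transducer α β (Q i))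
    (t : WitnessTree n α) : Prop :=
  t.label.S = Finset.univ ∧
    t.AtAllNodes (fun x k c => ∃ N L a b, WitnessNodeConditions D x k c N L a b)

/-! Both directions compare the outputs that the machines produce in parallel on one input. Each
sequential transducer is first completed by a sink to a total `Mealy` machine, whose dead state
records that no run exists.

A witness excludes a realiser `I`. By `Commits`, `I` is tied to a set `S` on a word if every machine
outside `S` is dead, or has an output that mismatches that of `I` or differs from it in length by
more than a bound; with a large bound, short accepted continuations must then be answered from `S`.
At the root `I` is trivially tied to all machines. At an inner node the loop is iterated until `I`
loops as well; from then on every live machine of `S` either keeps its delay to `I` forever or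
drifts away from `I`. The delay condition puts all those that keep their delay into one child, so
`I` can be tied to a subset of the label of that child. On the way down one meets a set that misses
an accepted continuation which `I` must answer. This is `not_commits_step`, iterated by tree
induction in `not_commits`.

Conversely, `Bad` holds at those configurations (current states, pending outputs, set of machines)
from which a witness tree grows, and `Bad.exists_tree` extracts the tree. If the initial
configuration is not bad, `realiser` follows a set of machines that stays not bad, emits the longest
common prefix of their outputs and stores the remainders. Dead machines can be discarded. When a
remainder becomes too long, `exists_splitting_loop` finds a loop that separates the set; if all
proper subsets were bad now, the set would have been bad when it was chosen, so a smaller set that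
is not bad exists. The set shrinks only finitely often, so the remainders stay bounded and finitely
many states are reachable. -/

/-! ### Combinatorics of words: mismatches, powers and pumping -/

section Words

variable {β : Type*}

theorem mismatch_iff {v w : List β} : Mismatch v w ↔ ¬ v <+: w ∧ ¬ w <+: v := by
  constructor
  · rintro ⟨m, hv, hw, h⟩
    exact ⟨fun hp => h (hp.getElem hv), fun hp => h (hp.getElem hw).symm⟩
  · rintro ⟨h1, h2⟩
    by_contra h
    simp only [Mismatch, not_exists, ne_eq, not_not] at h
    rcases le_total v.length w.length with hl | hl
    · refine h1 (List.prefix_iff_getElem.2 ⟨hl, fun m hm => h m hm (hm.trans_le hl)⟩)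
    · refine h2 (List.prefix_iff_getElem.2 ⟨hl, fun m hm => (h m (hm.trans_le hl) hm).symm⟩)

theorem Mismatch.symm {v w : List β} (h : Mismatch v w) : Mismatch w v := by
  rw [mismatch_iff] at *
  exact h.symm

theorem Mismatch.mono {v w v' w' : List β} (h : Mismatch v w) (hv : v <+: v') (hw : w <+: w') :
    Mismatch v' w' := by
  obtain ⟨m, h1, h2, h⟩ := h
  refine ⟨m, h1.trans_le hv.length_le, h2.trans_le hw.length_le, ?_⟩
  rwa [← hv.getElem h1, ← hw.getElem h2]

theorem Mismatch.append {v w : List β} (h : Mismatch v w) (s t : List β) :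
    Mismatch (v ++ s) (w ++ t) :=
  h.mono (List.prefix_append _ _) (List.prefix_append _ _)

theorem Mismatch.ne {v w : List β} (h : Mismatch v w) : v ≠ w := by
  rintro rfl
  exact (mismatch_iff.1 h).1 List.prefix_rfl

theorem mismatch_append_left_iff {c v w : List β} :
    Mismatch (c ++ v) (c ++ w) ↔ Mismatch v w := by
  simp [mismatch_iff, List.prefix_append_right_inj]

/-- If two words mismatch, then every sufficiently long word mismatches one of them. -/
theorem Mismatch.of_length_le {v w x : List β} (h : Mismatch v w) (hl : v.length ≤ x.length) :
    Mismatch x v ∨ Mismatch x w := by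
  obtain ⟨m, h1, h2, h⟩ := h
  have hx := h1.trans_le hl
  by_cases hv : x[m] = v[m]
  · exact Or.inr ⟨m, hx, h2, by rwa [hv]⟩
  · exact Or.inl ⟨m, hx, h1, hv⟩

/-- The power of a word. -/
def wordPow (v : List β) : ℕ → List β
  | 0 => []
  | k + 1 => v ++ wordPow v k

theorem wordPow_add (v : List β) (k l : ℕ) : wordPow v (k + l) = wordPow v k ++ wordPow v l := by
  induction k with
  | zero => simp [wordPow]
  | succ k ih => rw [Nat.succ_add, wordPow, wordPow, ih, List.append_assoc]

theorem wordPow_one (v : List β) : wordPow v 1 = v := by simp [wordPow]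

theorem wordPow_succ' (v : List β) (k : ℕ) : wordPow v (k + 1) = wordPow v k ++ v := by
  rw [wordPow_add, wordPow_one]

theorem wordPow_mul (v : List β) (k l : ℕ) : wordPow v (k * l) = wordPow (wordPow v k) l := by
  induction l with
  | zero => simp [wordPow]
  | succ l ih => rw [Nat.mul_succ, wordPow_add, ih, wordPow_succ']

theorem length_wordPow (v : List β) (k : ℕ) : (wordPow v k).length = k * v.length := by
  induction k with
  | zero => simp [wordPow]
  | succ k ih => simp [wordPow, ih]; ring

theorem wordPow_nil (k : ℕ) : wordPow ([] : List β) k = [] := by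
  rw [← List.length_eq_zero_iff, length_wordPow]; simp

theorem wordPow_prefix {v : List β} {k l : ℕ} (h : k ≤ l) : wordPow v k <+: wordPow v l := by
  obtain ⟨m, rfl⟩ := Nat.exists_eq_add_of_le h
  rw [wordPow_add]
  exact List.prefix_append _ _

theorem append_wordPow_of_conj {b d b' : List β} (h : b ++ d = d ++ b') (k : ℕ) :
    d ++ wordPow b' k = wordPow b k ++ d := by
  induction k with
  | zero => simp [wordPow]
  | succ k ih => rw [wordPow, wordPow, ← List.append_assoc, ← h, List.append_assoc, ih,
      List.append_assoc]

/-- For nonempty loops, the absence of mismatches forces `a' = a ++ d` and the conjugacy `b ++ d = d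
++ b'`. Iterating the loops therefore only moves the delay `d` along, and what follows is compared
as before. -/
theorem mismatch_pump_aux {a a' b b' : List β} (hb : b.length = b'.length)
    (hc : ∀ k, ¬ Mismatch (a ++ wordPow b k) (a' ++ wordPow b' k)) (hle : a.length ≤ a'.length)
    {s s' : List β} (h : Mismatch (a ++ s) (a' ++ s')) (k : ℕ) :
    Mismatch (a ++ wordPow b k ++ s) (a' ++ wordPow b' k ++ s') := by
  rcases b.eq_nil_or_concat' with rfl | ⟨b0, x, hbx⟩
  · obtain rfl : b' = [] := List.length_eq_zero_iff.1 hb.symm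
    simpa [wordPow_nil] using h
  have hpos : 0 < b.length := by simp [hbx]
  have h0 : a <+: a' := by
    have := hc 0
    simp only [wordPow, List.append_nil, mismatch_iff, not_and_or, not_not] at this
    rcases this with h | h
    · exact h
    · rw [h.eq_of_length_le hle]
  obtain ⟨d, rfl⟩ := h0
  have hc' : ∀ k, wordPow b k <+: d ++ wordPow b' k := by
    intro k
    have := hc k
    rw [List.append_assoc, mismatch_append_left_iff, mismatch_iff, not_and_or, not_not,
      not_not] at this
    rcases this with h | h
    · exact h
    · rw [h.eq_of_length_le (by simp [length_wordPow, hb])]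
  -- Both sides have the same length and are prefixes of one power of `b`; the exponent `d.length +
  -- 2` makes this power long enough, as `b` is nonempty.
  have hconj : b ++ d = d ++ b' := by
    have hd : ∀ l, d.length ≤ l → d <+: wordPow b l := fun l hl =>
      List.prefix_of_prefix_length_le (List.prefix_append _ _) (hc' l)
        (by rw [length_wordPow]; nlinarith)
    have h1 : b ++ d <+: wordPow b (d.length + 2) := by
      rw [wordPow, List.prefix_append_right_inj]
      exact hd _ (by omega)
    have h2 : d ++ b' <+: wordPow b (d.length + 2) := by
      refine List.prefix_of_prefix_length_le (l₃ := d ++ wordPow b' (d.length + 2)) ?_ (hc' _) ?_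
      · rw [wordPow, ← List.append_assoc]
        exact List.prefix_append _ _
      · rw [length_wordPow, List.length_append, ← hb]; nlinarith
    exact (List.prefix_of_prefix_length_le h1 h2 (by simp [hb]; omega)).eq_of_length
      (by simp [hb]; omega)
  have : a ++ d ++ wordPow b' k ++ s' = a ++ (wordPow b k ++ (d ++ s')) := by
    rw [List.append_assoc a, append_wordPow_of_conj hconj]; simp
  rw [this, List.append_assoc, mismatch_append_left_iff, mismatch_append_left_iff]
  rwa [List.append_assoc, mismatch_append_left_iff] at h

/-- If two words, pumped by loops of the same length, never mismatch, then pumping does not change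
their delay. -/
theorem mismatch_pump {a a' b b' : List β} (hb : b.length = b'.length)
    (hc : ∀ k, ¬ Mismatch (a ++ wordPow b k) (a' ++ wordPow b' k))
    {s s' : List β} (h : Mismatch (a ++ s) (a' ++ s')) (k : ℕ) :
    Mismatch (a ++ wordPow b k ++ s) (a' ++ wordPow b' k ++ s') := by
  rcases le_total a.length a'.length with hl | hl
  · exact mismatch_pump_aux hb hc hl h k
  · exact (mismatch_pump_aux hb.symm (fun k hm => hc k hm.symm) hl h.symm k).symm

end Words

/-! ### Total deterministic machines with output -/

/-- A complete deterministic automaton with output; `dead` is a set of states, closed under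
transitions and disjoint from the accepting ones. -/
structure Mealy (α β X : Type*) where
  step : X → α → X
  out : X → α → List β
  init : X
  acc : Set X
  fin : X → List β
  dead : Set X
  dead_step : ∀ x ∈ dead, ∀ a, step x a ∈ dead
  not_mem_acc_of_mem_dead : ∀ x ∈ dead, x ∉ acc

namespace Mealy

variable {α β X : Type*} (M : Mealy α β X)

/-- The state reached from `x` on a word. -/
def st (x : X) (u : List α) : X := u.foldl M.step x

/-- The word produced from `x` on a word. -/
def ot : X → List α → List β
  | _, [] => []
  | x, a :: u => M.out x a ++ ot (M.step x a) u

/-- The state reached on a word. -/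
def ev (u : List α) : X := M.st M.init u

/-- The word produced on a word. -/
def o (u : List α) : List β := M.ot M.init u

@[simp] theorem st_nil (x : X) : M.st x [] = x := rfl
@[simp] theorem st_cons (x : X) (a : α) (u : List α) : M.st x (a :: u) = M.st (M.step x a) u := rfl
@[simp] theorem ot_nil (x : X) : M.ot x [] = [] := rfl
@[simp] theorem ot_cons (x : X) (a : α) (u : List α) :
    M.ot x (a :: u) = M.out x a ++ M.ot (M.step x a) u := rfl

theorem st_append (x : X) (u v : List α) : M.st x (u ++ v) = M.st (M.st x u) v :=
  List.foldl_append

theorem ot_append (x : X) (u v : List α) : M.ot x (u ++ v) = M.ot x u ++ M.ot (M.st x u) v := by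
  induction u generalizing x with
  | nil => rfl
  | cons a u ih => simp [ih]

theorem ev_append (u v : List α) : M.ev (u ++ v) = M.st (M.ev u) v := M.st_append _ _ _

theorem o_append (u v : List α) : M.o (u ++ v) = M.o u ++ M.ot (M.ev u) v := M.ot_append _ _ _

theorem st_mem_dead {x : X} (h : x ∈ M.dead) (u : List α) : M.st x u ∈ M.dead := by
  induction u generalizing x with
  | nil => exact h
  | cons a u ih => exact ih (M.dead_step x h a)

theorem st_wordPow {x : X} {v : List α} (h : M.st x v = x) (k : ℕ) : M.st x (wordPow v k) = x := by
  induction k with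
  | zero => rfl
  | succ k ih => rw [wordPow, st_append, h, ih]

theorem ot_wordPow {x : X} {v : List α} (h : M.st x v = x) (k : ℕ) :
    M.ot x (wordPow v k) = wordPow (M.ot x v) k := by
  induction k with
  | zero => rfl
  | succ k ih => rw [wordPow, ot_append, h, ih, wordPow]

theorem exists_length_out_le [Finite α] [Finite X] : ∃ B, ∀ x a, (M.out x a).length ≤ B := by
  obtain ⟨B, hB⟩ := (Set.finite_range fun p : X × α => (M.out p.1 p.2).length).bddAbove
  exact ⟨B, fun x a => hB ⟨(x, a), rfl⟩⟩

theorem exists_length_fin_le [Finite X] : ∃ B, ∀ x, (M.fin x).length ≤ B := by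
  obtain ⟨B, hB⟩ := (Set.finite_range fun x => (M.fin x).length).bddAbove
  exact ⟨B, fun x => hB ⟨x, rfl⟩⟩

variable {M} in
theorem length_ot_le {B : ℕ} (h : ∀ x a, (M.out x a).length ≤ B) (x : X) (u : List α) :
    (M.ot x u).length ≤ B * u.length := by
  induction u generalizing x with
  | nil => simp
  | cons a u ih =>
    simp only [ot_cons, List.length_append, List.length_cons, mul_add, mul_one]
    have := h x a
    have := ih (M.step x a)
    omega

/-- Acceptance of a word. -/
def Acc (u : List α) : Prop := M.ev u ∈ M.acc

/-- The word produced on an accepted word, with the terminal output. -/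
def full (u : List α) : List β := M.o u ++ M.fin (M.ev u)

end Mealy

/-! ### Sequential transducers and disjoint unions in terms of total machines -/

namespace Transducer

variable {α β Q : Type*}

open Classical in
/-- The completion, by a sink state, of a sequential transducer. -/
noncomputable def toMealy (T : Transducer α β Q) (hT : T.IsSequential) :
    Mealy α β (Option Q) where
  step x a := x.bind fun p => if h : (T.step p a).Nonempty then some h.some else none
  out x a := x.elim [] fun p => if h : (T.step p a).Nonempty then T.out p a h.some else []
  init := some hT.1.choose
  acc := {x | ∃ p ∈ T.accept, x = some p}
  fin x := x.elim [] T.fin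
  dead := {none}
  dead_step := by rintro x rfl a; rfl
  not_mem_acc_of_mem_dead := by rintro x rfl ⟨p, _, h⟩; cases h

variable {T : Transducer α β Q} (hT : T.IsSequential)

include hT in
theorem run_iff {p q : Q} {u : List α} {v : List β} :
    T.Run p u v q ↔ (T.toMealy hT).st (some p) u = some q ∧ (T.toMealy hT).ot (some p) u = v := by
  have hstep : ∀ {p q : Q} {a : α}, q ∈ T.step p a →
      (T.toMealy hT).step (some p) a = some q ∧ (T.toMealy hT).out (some p) a = T.out p a q := by
    intro p q a h
    have hne : (T.step p a).Nonempty := ⟨q, h⟩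
    have : hne.some = q := hT.2 p a hne.some_mem h
    simp [toMealy, hne, this]
  constructor
  · intro h
    induction h with
    | nil => simp
    | cons h _ ih => simp [hstep h, ih]
  · induction u generalizing p v with
    | nil =>
      rintro ⟨h, rfl⟩
      obtain rfl : p = q := by simpa using h
      exact Run.nil p
    | cons a u ih =>
      rintro ⟨h, rfl⟩
      by_cases hne : (T.step p a).Nonempty
      · have := hstep hne.some_mem
        rw [Mealy.st_cons, this.1] at h
        rw [Mealy.ot_cons, this.1, this.2]
        exact Run.cons hne.some_mem (ih ⟨h, rfl⟩)
      · have h0 : (T.toMealy hT).step (some p) a = none := by simp [toMealy, hne]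
        rw [Mealy.st_cons, h0] at h
        have := (T.toMealy hT).st_mem_dead (x := none) rfl u
        rw [h] at this
        cases this

include hT in
theorem mem_start_iff {p : Q} : p ∈ T.start ↔ (T.toMealy hT).init = some p := by
  have h := hT.1.choose_spec
  constructor
  · intro hp
    exact congrArg some (h.2 p hp).symm
  · intro hp
    rw [← Option.some.inj hp]
    exact h.1

include hT in
theorem mem_rel_iff {u : List α} {v : List β} :
    (u, v) ∈ T.rel ↔ (T.toMealy hT).Acc u ∧ v = (T.toMealy hT).full u := by
  constructor
  · rintro ⟨p, hp, q, hq, w, hr, hv⟩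
    rw [mem_start_iff hT] at hp
    rw [run_iff hT, ← hp] at hr
    refine ⟨⟨q, hq, hr.1⟩, hv.trans ?_⟩
    rw [Mealy.full, Mealy.o, Mealy.ev, hr.1, hr.2]
    rfl
  · rintro ⟨⟨q, hq, h⟩, rfl⟩
    obtain ⟨p, hp, -⟩ := hT.1
    refine ⟨p, hp, q, hq, (T.toMealy hT).o u, ?_, ?_⟩
    · rw [run_iff hT, ← (mem_start_iff hT).1 hp]
      exact ⟨h, rfl⟩
    · simp only [Mealy.full]
      rw [h]
      rfl

include hT in
theorem mem_relDom_iff {u : List α} : u ∈ relDom T.rel ↔ (T.toMealy hT).Acc u := by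
  simp [relDom, mem_rel_iff hT]

include hT in
theorem hasInitialRun_iff {u : List α} :
    T.HasInitialRun u ↔ (T.toMealy hT).ev u ∉ (T.toMealy hT).dead := by
  constructor
  · rintro ⟨p, hp, v, q, hr⟩
    rw [run_iff hT, ← (mem_start_iff hT).1 hp] at hr
    rw [Mealy.ev, hr.1]
    rintro ⟨⟩
  · intro h
    obtain ⟨p, hp, -⟩ := hT.1
    obtain ⟨q, hq⟩ := Option.ne_none_iff_exists'.1 h
    exact ⟨p, hp, _, q, (run_iff hT).2 ⟨((mem_start_iff hT).1 hp) ▸ hq, rfl⟩⟩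

include hT in
theorem loop_iff {u v : List α} {a b : List β} :
    (∃ q ∈ T.start, ∃ p, T.Run q u a p ∧ T.Run p v b p) ↔
      (T.toMealy hT).ev u ∉ (T.toMealy hT).dead ∧
      (T.toMealy hT).st ((T.toMealy hT).ev u) v = (T.toMealy hT).ev u ∧
      a = (T.toMealy hT).o u ∧ b = (T.toMealy hT).ot ((T.toMealy hT).ev u) v := by
  constructor
  · rintro ⟨p, hp, q, h1, h2⟩
    rw [run_iff hT] at h1 h2
    rw [← (mem_start_iff hT).1 hp] at h1
    simp only [Mealy.ev, Mealy.o]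
    rw [h1.1]
    exact ⟨by rintro ⟨⟩, h2.1, h1.2.symm, h2.2.symm⟩
  · rintro ⟨h, h1, rfl, rfl⟩
    obtain ⟨p, hp, -⟩ := hT.1
    obtain ⟨q, hq⟩ := Option.ne_none_iff_exists'.1 h
    refine ⟨p, hp, q, (run_iff hT).2 ⟨((mem_start_iff hT).1 hp) ▸ hq, ?_⟩, (run_iff hT).2 ⟨?_, ?_⟩⟩
    · rw [← (mem_start_iff hT).1 hp]; rfl
    · rwa [hq] at h1
    · rw [hq]

theorem disjUnion_run_iff {ι : Type*} [DecidableEq ι] {Q : ι → Type*}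
    {D : ∀ i, Transducer α β (Q i)} {i : ι} {p : Q i} {u : List α} {v : List β} {q : Σ i, Q i} :
    (disjUnion D).Run ⟨i, p⟩ u v q ↔ ∃ q', q = ⟨i, q'⟩ ∧ (D i).Run p u v q' := by
  constructor
  · intro h
    generalize hx : (⟨i, p⟩ : Σ i, Q i) = x at h
    induction h generalizing p with
    | nil => exact ⟨p, hx.symm, Run.nil p⟩
    | cons h _ ih =>
      subst hx
      obtain ⟨q', hq', rfl⟩ := h
      obtain ⟨r', rfl, hr⟩ := ih rfl
      refine ⟨r', rfl, ?_⟩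
      simpa [disjUnion] using Run.cons hq' hr
  · rintro ⟨q, rfl, h⟩
    induction h with
    | nil => exact Run.nil _
    | @cons p q r a u v h _ ih =>
      have : (disjUnion D).out ⟨i, p⟩ a ⟨i, q⟩ = (D i).out p a q := by simp [disjUnion]
      rw [← this]
      exact Run.cons ⟨q, h, rfl⟩ ih

theorem mem_disjUnion_rel_iff {ι : Type*} [DecidableEq ι] {Q : ι → Type*}
    {D : ∀ i, Transducer α β (Q i)} {x : List α × List β} :
    x ∈ (disjUnion D).rel ↔ ∃ i, x ∈ (D i).rel := by
  constructor
  · rintro ⟨⟨i, p⟩, hp, q, hq, v, hr, hv⟩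
    obtain ⟨q', rfl, h⟩ := disjUnion_run_iff.1 hr
    exact ⟨i, p, hp, q', hq, v, h, hv⟩
  · rintro ⟨i, p, hp, q, hq, v, hr, hv⟩
    exact ⟨⟨i, p⟩, hp, ⟨i, q⟩, hq, v, disjUnion_run_iff.2 ⟨q, rfl, hr⟩, hv⟩

theorem mem_relDom_disjUnion_iff {ι : Type*} [DecidableEq ι] {Q : ι → Type*}
    {D : ∀ i, Transducer α β (Q i)} {u : List α} :
    u ∈ relDom (disjUnion D).rel ↔ ∃ i, u ∈ relDom (D i).rel := by
  simp only [relDom, Set.mem_ofPred_eq, mem_disjUnion_rel_iff]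
  exact exists_comm

end Transducer

/-! ### From a machine with finitely many reachable states to a sequential transducer -/

namespace Mealy

variable {α β X : Type*}

/-- The restriction of a Mealy machine to its reachable states, as a transducer on a type of
indices for these states. -/
def toTransducer (M : Mealy α β X) {P : Type} (e : Set.range M.ev ≃ P) : Transducer α β P where
  step p a := {q | (e.symm q : X) = M.step (e.symm p) a}
  start := {q | (e.symm q : X) = M.init}
  accept := {q | (e.symm q : X) ∈ M.acc}
  out p a _ := M.out (e.symm p) a
  fin p := M.fin (e.symm p)

theorem toTransducer_run_iff (M : Mealy α β X) {P : Type} (e : Set.range M.ev ≃ P) {p q : P}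
    {u : List α} {v : List β} :
    (M.toTransducer e).Run p u v q ↔ (e.symm q : X) = M.st (e.symm p) u ∧
      v = M.ot (e.symm p) u := by
  constructor
  · intro h
    induction h with
    | nil => simp
    | cons h _ ih =>
      have h : _ = _ := h
      rw [h] at ih
      exact ⟨ih.1, by rw [ih.2]; rfl⟩
  · induction u generalizing p v with
    | nil =>
      rintro ⟨h, rfl⟩
      obtain rfl : q = p := e.symm.injective (Subtype.ext h)
      exact Transducer.Run.nil q
    | cons a u ih =>
      rintro ⟨h, rfl⟩
      obtain ⟨w, hw⟩ := (e.symm p).2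
      let r : P := e ⟨M.step (e.symm p) a, w ++ [a], by rw [ev_append, hw]; rfl⟩
      have hr : (e.symm r : X) = M.step (e.symm p) a := by simp [r]
      exact Transducer.Run.cons (T := M.toTransducer e) (q := r) hr
        (ih ⟨by rw [h, hr]; rfl, by rw [hr]⟩)

theorem sequentiallyRealisable (M : Mealy α β X) (hM : (Set.range M.ev).Finite)
    {S : Set (List α × List β)} (hdom : ∀ u, u ∈ relDom S → M.Acc u)
    (hS : ∀ u, M.Acc u → (u, M.full u) ∈ S) : SequentiallyRealisable S := by
  have := hM.to_subtype
  obtain ⟨n, ⟨e⟩⟩ := Finite.exists_equiv_fin (Set.range M.ev)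
  have hrel : ∀ u v, (u, v) ∈ (M.toTransducer e).rel ↔ M.Acc u ∧ v = M.full u := by
    intro u v
    constructor
    · rintro ⟨p, hp, q, hq, w, hr, hv⟩
      rw [toTransducer_run_iff] at hr
      have hp : _ = _ := hp
      rw [hp] at hr
      have hq : _ ∈ M.acc := hq
      refine ⟨by rwa [hr.1] at hq, hv.trans ?_⟩
      change w ++ M.fin _ = _
      rw [hr.1, hr.2]
      rfl
    · rintro ⟨hu, rfl⟩
      refine ⟨e ⟨M.init, [], rfl⟩, by simp [toTransducer], e ⟨M.ev u, u, rfl⟩,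
        by simpa [toTransducer, Acc] using hu, M.o u, ?_, ?_⟩
      · rw [toTransducer_run_iff]
        simp [ev, o]
      · simp [full, toTransducer]
  refine ⟨Fin n, inferInstance, M.toTransducer e, ⟨⟨e ⟨M.init, [], rfl⟩, by simp [toTransducer], ?_⟩,
    ?_⟩, ?_, ?_⟩
  · intro q hq
    have hq : _ = _ := hq
    rw [← e.symm_apply_eq]
    exact Subtype.ext hq
  · intro p a q hq r hr
    have hq : _ = _ := hq
    have hr : _ = _ := hr
    exact e.symm.injective (Subtype.ext (hq.trans hr.symm))
  · ext u
    constructor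
    · rintro ⟨v, hv⟩
      exact ⟨_, hS u ((hrel u v).1 hv).1⟩
    · intro hu
      exact ⟨_, (hrel u _).2 ⟨hdom u hu, rfl⟩⟩
  · intro u v h
    obtain ⟨hu, rfl⟩ := (hrel u v).1 h
    exact hS u hu

end Mealy

/-! ### A witness excludes a realiser -/

/-- This is the dichotomy at a loop. Loops of different lengths make the length gap grow linearly,
and a mismatch that occurs once persists under further pumping. -/
theorem eventually_mismatch_or_length {β : Type*} {γ δ a b : List β}
    (h : ¬ (δ.length = b.length ∧ ∀ k, ¬ Mismatch (γ ++ wordPow δ k) (a ++ wordPow b k))) (B : ℕ) :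
    ∀ᶠ k in Filter.atTop, Mismatch (γ ++ wordPow δ k) (a ++ wordPow b k) ∨
      (γ ++ wordPow δ k).length + B < (a ++ wordPow b k).length ∨
      (a ++ wordPow b k).length + B < (γ ++ wordPow δ k).length := by
  simp only [List.length_append, length_wordPow, Filter.eventually_atTop]
  rcases lt_trichotomy δ.length b.length with hl | hl | hl
  · refine ⟨γ.length + B + 1, fun k hk => Or.inr (Or.inl ?_)⟩
    have : k * (δ.length + 1) ≤ k * b.length := Nat.mul_le_mul_left _ hl
    rw [mul_add] at this
    omega
  · obtain ⟨k, hk⟩ : ∃ k, Mismatch (γ ++ wordPow δ k) (a ++ wordPow b k) := by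
      by_contra hc
      exact h ⟨hl, not_exists.1 hc⟩
    refine ⟨k, fun l hkl => Or.inl (hk.mono ?_ ?_)⟩
    · exact (List.prefix_append_right_inj _).2 (wordPow_prefix hkl)
    · exact (List.prefix_append_right_inj _).2 (wordPow_prefix hkl)
  · refine ⟨a.length + B + 1, fun k hk => Or.inr (Or.inr ?_)⟩
    have : k * (b.length + 1) ≤ k * δ.length := Nat.mul_le_mul_left _ hl
    rw [mul_add] at this
    omega

/-- Two words pumped by loops of the same positive length that never mismatch a third one do not
mismatch each other. -/
theorem not_mismatch_of_pump {β : Type*} {γ δ a a' b b' : List β} {m : ℕ} (hm : 0 < m)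
    (hpos : b ≠ []) (hb : δ.length = (wordPow b m).length) (l : ℕ)
    (h : ∀ k, ¬ Mismatch (γ ++ wordPow δ k) (a ++ wordPow b l ++ wordPow (wordPow b m) k))
    (h' : ∀ k, ¬ Mismatch (γ ++ wordPow δ k) (a' ++ wordPow b' l ++ wordPow (wordPow b' m) k))
    (k : ℕ) : ¬ Mismatch (a ++ wordPow b k) (a' ++ wordPow b' k) := by
  intro hmis
  have hbpos : 0 < b.length := List.length_pos_iff.2 hpos
  -- `K` is so large that `γ ++ wordPow δ K` is at least as long as `a ++ wordPow b k`, and that `l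
  -- + m * K ≥ k` copies of `b` and `b'` occur in the words compared with it. A mismatch of the two
  -- words would then pass to one of those comparisons.
  set K := k + (a ++ wordPow b k).length with hK
  have hkm : k ≤ l + m * K := by nlinarith
  have hlen : (a ++ wordPow b k).length ≤ (γ ++ wordPow δ K).length := by
    rw [List.length_append (as := γ), length_wordPow, hb, length_wordPow]
    have : 0 < m * b.length := Nat.mul_pos hm hbpos
    nlinarith
  rcases hmis.of_length_le hlen with hx | hx
  · refine h K (hx.mono List.prefix_rfl ?_)
    rw [← wordPow_mul, List.append_assoc, ← wordPow_add, List.prefix_append_right_inj]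
    exact wordPow_prefix hkm
  · refine h' K (hx.mono List.prefix_rfl ?_)
    rw [← wordPow_mul, List.append_assoc, ← wordPow_add, List.prefix_append_right_inj]
    exact wordPow_prefix hkm

namespace Mealy

/-- The loop of a witness node concerns only the given transducers. By the pigeonhole principle the
realiser too is eventually periodic under `v`, so a power of `v` is a loop for all of them. -/
theorem exists_loop {α β X : Type*} [Finite X] (M : Mealy α β X) (u v : List α) :
    ∃ l m, 0 < m ∧ M.st (M.ev (u ++ wordPow v l)) (wordPow v m) = M.ev (u ++ wordPow v l) := by
  obtain ⟨k, l, hkl, h⟩ := Finite.exists_ne_map_eq_of_infinite fun k => M.ev (u ++ wordPow v k)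
  wlog hlt : k < l generalizing k l
  · exact this l k hkl.symm h.symm (by omega)
  obtain ⟨m, rfl⟩ := Nat.exists_eq_add_of_lt hlt
  refine ⟨k, m + 1, by omega, ?_⟩
  rw [← ev_append, List.append_assoc, ← wordPow_add]
  exact h.symm

variable {ι α β Y : Type*} {X : ι → Type*} (M : ∀ i, Mealy α β (X i)) (I : Mealy α β Y)

/-- Some extension of `u` is accepted by some machine, but by none of those in `S`. -/
def Uncovered (u : List α) (S : Finset ι) : Prop :=
  ∃ w, (∃ j, (M j).Acc (u ++ w)) ∧ ∀ i ∈ S, ¬ (M i).Acc (u ++ w)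

/-- The machines in `S` reach the same states on `u` and on `c`, and every mismatch between
outputs starting with those on `u` is one between outputs starting with those on `c`. -/
structure SameDelays (u c : List α) (S : Finset ι) : Prop where
  ev_eq : ∀ i ∈ S, (M i).ev c = (M i).ev u
  mismatch : ∀ i ∈ S, ∀ j ∈ S, ∀ s t, Mismatch ((M i).o u ++ s) ((M j).o u ++ t) →
    Mismatch ((M i).o c ++ s) ((M j).o c ++ t)

/-- On the word `U`, the machine `I` is as far from those in `S` as it is on the word `c`,
and more than `B` away from all other ones. -/
structure Commits (S : Finset ι) (c U : List α) (B : ℕ) : Prop where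
  ev_eq : I.ev U = I.ev c
  ev_eq_of_mem : ∀ i ∈ S, (M i).ev U = (M i).ev c
  length_eq : ∀ i ∈ S, (I.o U).length + ((M i).o c).length = (I.o c).length + ((M i).o U).length
  mismatch : ∀ i ∈ S, ∀ s t, Mismatch (I.o c ++ s) ((M i).o c ++ t) →
    Mismatch (I.o U ++ s) ((M i).o U ++ t)
  of_notMem : ∀ i ∉ S, (M i).ev U ∈ (M i).dead ∨ Mismatch (I.o U) ((M i).o U) ∨
    (I.o U).length + B < ((M i).o U).length ∨ ((M i).o U).length + B < (I.o U).length

variable {M I}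

/-- If `I` commits to `S` on `U`, with a large bound, then an accepted extension of `U` is accepted
by a machine in `S`. -/
theorem Commits.exists_mem_acc {B₀ : ℕ} (hB : ∀ i x a, ((M i).out x a).length ≤ B₀)
    (hBI : ∀ x a, (I.out x a).length ≤ B₀) (hF : ∀ i x, ((M i).fin x).length ≤ B₀)
    (hFI : ∀ x, (I.fin x).length ≤ B₀)
    (hI : ∀ u, I.Acc u → ∃ i, (M i).Acc u ∧ (M i).full u = I.full u)
    {S : Finset ι} {c U w : List α} (h : Commits M I S c U (B₀ * w.length + B₀))
    (hw : I.Acc (U ++ w)) : ∃ j ∈ S, (M j).Acc (U ++ w) := by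
  obtain ⟨j, hj, heq⟩ := hI _ hw
  refine ⟨j, ?_, hj⟩
  by_contra hjS
  have h1 := length_ot_le hBI (I.ev U) w
  have h2 := length_ot_le (hB j) ((M j).ev U) w
  have h3 := hFI (I.ev (U ++ w))
  have h4 := hF j ((M j).ev (U ++ w))
  have hlen := congrArg List.length heq
  simp only [full, o_append, List.length_append] at hlen
  rcases h.of_notMem j hjS with hd | hd | hd | hd
  · rw [Acc, ev_append] at hj
    exact (M j).not_mem_acc_of_mem_dead _ ((M j).st_mem_dead hd w) hj
  · rw [full, full, o_append, o_append, List.append_assoc, List.append_assoc] at heq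
    exact (hd.append _ _).ne heq.symm
  · omega
  · omega

section Step

variable [DecidableEq ι] {B₀ : ℕ} {S : Finset ι} {u c v V : List α} {L : Finset ι}

/-- The machines in `S'` keep their delay to `I` by `mismatch_pump`. Those in `S` but not in `S'`
are dead, or have been driven away by the `k` loops with a margin that survives reading `r`. Those
outside `S` were so far away on `U` that the whole added word uses up only the surplus over `B`. -/
theorem commits_step (hB : ∀ i x a, ((M i).out x a).length ≤ B₀)
    (hBI : ∀ x a, (I.out x a).length ≤ B₀)
    {S' : Finset ι} {c₀ e : List α} {B k : ℕ} {r U : List α} (hS' : S' ⊆ S)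
    (hVI : I.st (I.ev (c ++ e)) V = I.ev (c ++ e))
    (hV : ∀ i ∈ S, (M i).ev c ∉ (M i).dead → (M i).st ((M i).ev (c ++ e)) V = (M i).ev (c ++ e))
    (hV' : ∀ i ∈ S', (M i).st ((M i).ev (c ++ e)) V = (M i).ev (c ++ e))
    (hkeep : ∀ i ∈ S', (I.ot (I.ev (c ++ e)) V).length = ((M i).ot ((M i).ev (c ++ e)) V).length ∧
      ∀ k, ¬ Mismatch (I.o (c ++ e) ++ wordPow (I.ot (I.ev (c ++ e)) V) k)
        ((M i).o (c ++ e) ++ wordPow ((M i).ot ((M i).ev (c ++ e)) V) k))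
    (hc₀ : c₀ = c ++ e ++ r)
    (hkill : ∀ i ∈ S, i ∉ S' → (M i).ev c ∉ (M i).dead →
      Mismatch (I.o (c ++ e) ++ wordPow (I.ot (I.ev (c ++ e)) V) k)
        ((M i).o (c ++ e) ++ wordPow ((M i).ot ((M i).ev (c ++ e)) V) k) ∨
      (I.o (c ++ e) ++ wordPow (I.ot (I.ev (c ++ e)) V) k).length + (B + B₀ * r.length) <
        ((M i).o (c ++ e) ++ wordPow ((M i).ot ((M i).ev (c ++ e)) V) k).length ∨
      ((M i).o (c ++ e) ++ wordPow ((M i).ot ((M i).ev (c ++ e)) V) k).length +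
        (B + B₀ * r.length) < (I.o (c ++ e) ++ wordPow (I.ot (I.ev (c ++ e)) V) k).length)
    (hU : Commits M I S c U (B + B₀ * (e ++ wordPow V k ++ r).length)) :
    Commits M I S' c₀ (U ++ (e ++ wordPow V k ++ r)) B := by
  subst hc₀
  have hoI : ∀ x, I.o (U ++ (e ++ wordPow V k ++ x)) = I.o U ++ (I.ot (I.ev c) e ++
      wordPow (I.ot (I.ev (c ++ e)) V) k ++ I.ot (I.ev (c ++ e)) x) := by
    intro x
    rw [o_append, ot_append, ot_append, st_append, hU.ev_eq, ← ev_append, I.ot_wordPow hVI,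
      I.st_wordPow hVI]
  have hoI' : ∀ x, I.o (c ++ e ++ x) = I.o c ++ (I.ot (I.ev c) e ++ I.ot (I.ev (c ++ e)) x) := by
    intro x
    rw [o_append, o_append, List.append_assoc]
  have hoM : ∀ i ∈ S, (M i).st ((M i).ev (c ++ e)) V = (M i).ev (c ++ e) → ∀ x,
      (M i).o (U ++ (e ++ wordPow V k ++ x)) = (M i).o U ++ ((M i).ot ((M i).ev c) e ++
      wordPow ((M i).ot ((M i).ev (c ++ e)) V) k ++ (M i).ot ((M i).ev (c ++ e)) x) := by
    intro i hi hVi x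
    rw [o_append, ot_append, ot_append, st_append, hU.ev_eq_of_mem i hi, ← ev_append,
      (M i).ot_wordPow hVi, (M i).st_wordPow hVi]
  have hoM' : ∀ i x, (M i).o (c ++ e ++ x) =
      (M i).o c ++ ((M i).ot ((M i).ev c) e ++ (M i).ot ((M i).ev (c ++ e)) x) := by
    intro i x
    rw [o_append, o_append, List.append_assoc]
  have hevM : ∀ i ∈ S, (M i).st ((M i).ev (c ++ e)) V = (M i).ev (c ++ e) →
      (M i).ev (U ++ (e ++ wordPow V k ++ r)) = (M i).ev (c ++ e ++ r) := by
    intro i hi hVi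
    rw [ev_append, st_append, st_append, hU.ev_eq_of_mem i hi, ← ev_append,
      (M i).st_wordPow hVi, ← ev_append]
  refine ⟨?_, ?_, ?_, ?_, ?_⟩
  · rw [ev_append, st_append, st_append, hU.ev_eq, ← ev_append, I.st_wordPow hVI, ← ev_append]
  · exact fun i hi => hevM i (hS' hi) (hV' i hi)
  · intro i hi
    have h1 := hU.length_eq i (hS' hi)
    have h2 := (hkeep i hi).1
    rw [hoI, hoI', hoM i (hS' hi) (hV' i hi), hoM']
    simp only [List.length_append, length_wordPow, h2]
    omega
  · intro i hi s t h
    rw [hoI, hoM i (hS' hi) (hV' i hi), List.append_assoc _ _ s, List.append_assoc _ _ t]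
    apply hU.mismatch i (hS' hi)
    rw [I.o_append (c ++ e), (M i).o_append (c ++ e)] at h
    have := mismatch_pump (hkeep i hi).1 (hkeep i hi).2
      (s := I.ot (I.ev (c ++ e)) r ++ s) (s' := (M i).ot ((M i).ev (c ++ e)) r ++ t)
      (by simpa only [List.append_assoc] using h) k
    simpa only [o_append, List.append_assoc] using this
  · intro i hi
    by_cases hiS : i ∈ S
    · by_cases hd : (M i).ev c ∈ (M i).dead
      · left
        rw [ev_append, hU.ev_eq_of_mem i hiS]
        exact (M i).st_mem_dead hd _
      have hVi := hV i hiS hd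
      right
      have h1 := length_ot_le hBI (I.ev (c ++ e)) r
      have h2 := length_ot_le (hB i) ((M i).ev (c ++ e)) r
      have h3 := hU.length_eq i hiS
      rw [hoI, hoM i hiS hVi]
      rcases hkill i hiS hi hd with h | h | h
      · left
        rw [o_append, o_append, List.append_assoc, List.append_assoc] at h
        have := (hU.mismatch i hiS _ _ h).append (I.ot (I.ev (c ++ e)) r)
          ((M i).ot ((M i).ev (c ++ e)) r)
        simpa only [List.append_assoc] using this
      · right; left
        simp only [o_append, List.length_append] at h ⊢
        omega
      · right; right
        simp only [o_append, List.length_append] at h ⊢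
        omega
    · have h1 := length_ot_le hBI (I.ev U) (e ++ wordPow V k ++ r)
      have h2 := length_ot_le (hB i) ((M i).ev U) (e ++ wordPow V k ++ r)
      rw [ev_append, o_append, o_append]
      rcases hU.of_notMem i hiS with h | h | h | h
      · exact Or.inl ((M i).st_mem_dead h _)
      · exact Or.inr (Or.inl (h.append _ _))
      · right; right; left
        rw [List.length_append, List.length_append]
        omega
      · right; right; right
        rw [List.length_append, List.length_append]
        omega

/-- The indices `κ` play the role of the children, with sets `A y` and words `w y`. Bounds are found
from the children upwards: the bound at a node must pay for the bound at the selected child and for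
the word that leads there. -/
theorem not_commits_step [Finite Y] (hB : ∀ i x a, ((M i).out x a).length ≤ B₀)
    (hBI : ∀ x a, (I.out x a).length ≤ B₀) (hF : ∀ i x, ((M i).fin x).length ≤ B₀)
    (hFI : ∀ x, (I.fin x).length ≤ B₀)
    (hdom : ∀ u i, (M i).Acc u → I.Acc u)
    (hI : ∀ u, I.Acc u → ∃ i, (M i).Acc u ∧ (M i).full u = I.full u)
    (hdead : ∀ i ∈ S, i ∉ L → (M i).ev u ∈ (M i).dead)
    (hloop : ∀ i ∈ L, (M i).st ((M i).ev u) v = (M i).ev u)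
    {κ : Type*} [Nonempty κ] (A : κ → Finset ι) (w : κ → List α)
    (hcover : ∀ i ∈ L, ∃ y, i ∈ A y) (hpre : ∀ y, u <+: w y)
    (hsep : ∀ y z, y ≠ z → ∀ i ∈ A y, ∀ j ∈ A z, i ∈ L → j ∈ L →
      ((M i).ot ((M i).ev u) v).length ≠ ((M j).ot ((M j).ev u) v).length ∨
      ((M i).ot ((M i).ev u) v ++ (M j).ot ((M j).ev u) v ≠ [] ∧
        Mismatch ((M i).o u) ((M j).o u)))
    (IH : ∀ y, ∀ T ⊆ A y, ∀ c, SameDelays M (w y) c T → ¬ Uncovered M (w y) T →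
      ∃ B, ∀ U, ¬ Commits M I T c U B)
    (hc : SameDelays M u c S) (hC : ¬ Uncovered M u S) : ∃ B, ∀ U, ¬ Commits M I S c U B := by
  classical
  obtain ⟨l, m, hm, hVI⟩ := I.exists_loop c v
  set e := wordPow v l with he
  set V := wordPow v m with hVdef
  have hev : ∀ i ∈ S, i ∈ L → (M i).ev (c ++ e) = (M i).ev u := by
    intro i hi hiL
    rw [ev_append, hc.ev_eq i hi, he, (M i).st_wordPow (hloop i hiL)]
  have hV : ∀ i ∈ S, i ∈ L → (M i).st ((M i).ev (c ++ e)) V = (M i).ev (c ++ e) := by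
    intro i hi hiL
    rw [hev i hi hiL, hVdef, (M i).st_wordPow (hloop i hiL)]
  have ho : ∀ i ∈ S, i ∈ L →
      (M i).o (c ++ e) = (M i).o c ++ wordPow ((M i).ot ((M i).ev u) v) l := by
    intro i hi hiL
    rw [o_append, hc.ev_eq i hi, he, (M i).ot_wordPow (hloop i hiL)]
  have hb : ∀ i ∈ S, i ∈ L →
      (M i).ot ((M i).ev (c ++ e)) V = wordPow ((M i).ot ((M i).ev u) v) m := by
    intro i hi hiL
    rw [hev i hi hiL, hVdef, (M i).ot_wordPow (hloop i hiL)]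
  have hL : ∀ i ∈ S, (M i).ev c ∉ (M i).dead → i ∈ L := by
    intro i hi hd
    by_contra hiL
    exact hd (hc.ev_eq i hi ▸ hdead i hi hiL)
  -- The machines whose delay to `I` is unaffected by pumping; only these remain in the set.
  let keep : ι → Prop := fun i =>
    (I.ot (I.ev (c ++ e)) V).length = ((M i).ot ((M i).ev (c ++ e)) V).length ∧
      ∀ k, ¬ Mismatch (I.o (c ++ e) ++ wordPow (I.ot (I.ev (c ++ e)) V) k)
        ((M i).o (c ++ e) ++ wordPow ((M i).ot ((M i).ev (c ++ e)) V) k)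
  set S' := (S ∩ L).filter keep with hS'
  have hmem : ∀ i, i ∈ S' ↔ i ∈ S ∧ i ∈ L ∧ keep i := by
    intro i
    rw [hS', Finset.mem_filter, Finset.mem_inter, and_assoc]
  have hlen : ∀ i ∈ S', ∀ j ∈ S',
      ((M i).ot ((M i).ev u) v).length = ((M j).ot ((M j).ev u) v).length := by
    intro i hi j hj
    obtain ⟨hiS, hiL, hik⟩ := (hmem i).1 hi
    obtain ⟨hjS, hjL, hjk⟩ := (hmem j).1 hj
    have := hik.1.symm.trans hjk.1
    rw [hb i hiS hiL, hb j hjS hjL, length_wordPow, length_wordPow] at this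
    exact Nat.eq_of_mul_eq_mul_left hm this
  have hpump : ∀ i ∈ S', ∀ j ∈ S', (M i).ot ((M i).ev u) v ≠ [] → ∀ k,
      ¬ Mismatch ((M i).o c ++ wordPow ((M i).ot ((M i).ev u) v) k)
        ((M j).o c ++ wordPow ((M j).ot ((M j).ev u) v) k) := by
    intro i hi j hj hne
    obtain ⟨hiS, hiL, hik⟩ := (hmem i).1 hi
    obtain ⟨hjS, hjL, hjk⟩ := (hmem j).1 hj
    have h1 := hik.1
    have h2 := hik.2
    have h3 := hjk.2
    rw [hb i hiS hiL] at h1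
    simp only [hb i hiS hiL, ho i hiS hiL] at h2
    simp only [hb j hjS hjL, ho j hjS hjL] at h3
    exact not_mismatch_of_pump hm hne h1 l h2 h3
  -- Machines in `S'` have loop outputs of equal length, since `I` keeps pace with all of them. So
  -- two from different children would mismatch, with nonempty loops; but the long outputs of `I`
  -- agree with both, which excludes this.
  obtain ⟨y, hy⟩ : ∃ y, S' ⊆ A y := by
    rcases S'.eq_empty_or_nonempty with h0 | ⟨i, hi⟩
    · exact ⟨Classical.arbitrary κ, by simp [h0]⟩
    obtain ⟨hiS, hiL, -⟩ := (hmem i).1 hi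
    obtain ⟨y, hy⟩ := hcover i hiL
    refine ⟨y, fun j hj => ?_⟩
    obtain ⟨hjS, hjL, -⟩ := (hmem j).1 hj
    obtain ⟨z, hz⟩ := hcover j hjL
    by_cases hyz : y = z
    · exact hyz ▸ hz
    exfalso
    rcases hsep y z hyz i hy j hz hiL hjL with h | ⟨h, hmis⟩
    · exact h (hlen i hi j hj)
    · have hne : (M i).ot ((M i).ev u) v ≠ [] := by
        intro h0
        have h1 := hlen i hi j hj
        rw [h0] at h1
        exact h (by rw [h0, List.length_eq_zero_iff.1 h1.symm]; rfl)
      have := hc.mismatch i hiS j hjS [] [] (by simpa using hmis)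
      exact hpump i hi j hj hne 0 this
  obtain ⟨r, hr⟩ := hpre y
  have hevr : ∀ i ∈ S, i ∈ L → (M i).ev (c ++ e ++ r) = (M i).ev (w y) := by
    intro i hi hiL
    rw [ev_append, hev i hi hiL, ← hr, ev_append]
  have hcy : SameDelays M (w y) (c ++ e ++ r) S' := by
    refine ⟨fun i hi => hevr i ((hmem i).1 hi).1 ((hmem i).1 hi).2.1, ?_⟩
    intro i hi j hj s t h
    obtain ⟨hiS, hiL, -⟩ := (hmem i).1 hi
    obtain ⟨hjS, hjL, -⟩ := (hmem j).1 hj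
    rw [← hr, o_append, o_append, List.append_assoc, List.append_assoc] at h
    rw [o_append _ _ r, o_append _ _ r, ho i hiS hiL, ho j hjS hjL, hev i hiS hiL, hev j hjS hjL]
    have h' := hc.mismatch i hiS j hjS _ _ h
    rw [List.append_assoc _ _ s, List.append_assoc _ _ t]
    by_cases h0 : (M i).ot ((M i).ev u) v = []
    · have h1 := hlen i hi j hj
      rw [h0] at h1
      rw [h0, List.length_eq_zero_iff.1 h1.symm]
      simpa [wordPow_nil] using h'
    · exact mismatch_pump (hlen i hi j hj) (hpump i hi j hj h0) h' l
  -- If `S'` misses a continuation `x` accepted by some machine, then a machine of `S` accepts it,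
  -- as `S` is not uncovered. So `I` has to accept `x` after `U` but can answer only from `S'`, none
  -- of whose machines accepts. Otherwise the induction hypothesis applies to the child.
  obtain ⟨B, hBy⟩ : ∃ B, ∀ U, (∀ i ∈ S, i ∈ L → (M i).ev U = (M i).ev (w y)) →
      ¬ Commits M I S' (c ++ e ++ r) U B := by
    by_cases hun : Uncovered M (w y) S'
    · obtain ⟨x, ⟨j, hj⟩, hx⟩ := hun
      refine ⟨B₀ * x.length + B₀, fun U hU hcom => ?_⟩
      obtain ⟨i, hiS, hi⟩ : ∃ i ∈ S, (M i).Acc (w y ++ x) := by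
        by_contra hcon
        push Not at hcon
        refine hC ⟨r ++ x, ⟨j, ?_⟩, ?_⟩
        · rwa [← List.append_assoc, hr]
        · rwa [← List.append_assoc, hr]
      have hiL : i ∈ L := by
        by_contra hiL
        rw [← hr, List.append_assoc, Acc, ev_append] at hi
        exact (M i).not_mem_acc_of_mem_dead _ ((M i).st_mem_dead (hdead i hiS hiL) _) hi
      have hiU : (M i).Acc (U ++ x) := by
        rw [Acc, ev_append] at hi ⊢
        rwa [hU i hiS hiL]
      obtain ⟨i', hi'S, hi'⟩ := hcom.exists_mem_acc hB hBI hF hFI hI (hdom _ i hiU)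
      refine hx i' hi'S ?_
      rw [Acc, ev_append] at hi' ⊢
      rwa [← hU i' ((hmem i').1 hi'S).1 ((hmem i').1 hi'S).2.1]
    · obtain ⟨B, h⟩ := IH y S' hy _ hcy hun
      exact ⟨B, fun U _ => h U⟩
  -- The extra `B₀ * r.length` compensates for the letters written while reading `r` after the
  -- loops.
  have hkill : ∀ᶠ k in Filter.atTop, ∀ i ∈ (S ∩ L) \ S',
      Mismatch (I.o (c ++ e) ++ wordPow (I.ot (I.ev (c ++ e)) V) k)
        ((M i).o (c ++ e) ++ wordPow ((M i).ot ((M i).ev (c ++ e)) V) k) ∨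
      (I.o (c ++ e) ++ wordPow (I.ot (I.ev (c ++ e)) V) k).length + (B + B₀ * r.length) <
        ((M i).o (c ++ e) ++ wordPow ((M i).ot ((M i).ev (c ++ e)) V) k).length ∨
      ((M i).o (c ++ e) ++ wordPow ((M i).ot ((M i).ev (c ++ e)) V) k).length +
        (B + B₀ * r.length) < (I.o (c ++ e) ++ wordPow (I.ot (I.ev (c ++ e)) V) k).length := by
    rw [Filter.eventually_all_finset]
    intro i hi
    rw [Finset.mem_sdiff, Finset.mem_inter] at hi
    refine eventually_mismatch_or_length (fun hk => hi.2 ?_) _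
    exact (hmem i).2 ⟨hi.1.1, hi.1.2, hk⟩
  obtain ⟨k, hk⟩ := hkill.exists
  refine ⟨B + B₀ * (e ++ wordPow V k ++ r).length, fun U hU => hBy _ ?_
    (commits_step hB hBI (fun i hi => ((hmem i).1 hi).1) hVI (fun i hi hd => hV i hi (hL i hi hd))
      (fun i hi => hV i ((hmem i).1 hi).1 ((hmem i).1 hi).2.1) (fun i hi => ((hmem i).1 hi).2.2)
      rfl (fun i hi hi' hd => hk i ?_) hU)⟩
  · intro i hi hiL
    rw [ev_append, st_append, st_append, hU.ev_eq_of_mem i hi, ← ev_append,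
      (M i).st_wordPow (hV i hi hiL), ← ev_append]
    exact hevr i hi hiL
  · exact Finset.mem_sdiff.2 ⟨Finset.mem_inter.2 ⟨hi, hL i hi hd⟩, hi'⟩

end Step

end Mealy

namespace WitnessTree

open Mealy

variable {α β Y : Type*} {n : ℕ} {Q : Fin n → Type*} {D : ∀ i, Transducer α β (Q i)}

theorem uncovered_iff (hseq : ∀ i, (D i).IsSequential) {u : List α} {S : Finset (Fin n)} :
    Uncovered (fun i => (D i).toMealy (hseq i)) u S ↔
      ∃ w, u ++ w ∈ relDom (Transducer.disjUnion D).rel ∧ ∀ i ∈ S, u ++ w ∉ relDom (D i).rel := by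
  simp only [Uncovered, Transducer.mem_relDom_disjUnion_iff, Transducer.mem_relDom_iff (hseq _)]

/-- The induction runs over arbitrary subsets `S` of the label and over words `c` other than that of
the node, because machines are lost on the way and loops have been inserted into the input. -/
theorem not_commits [Finite Y] (hseq : ∀ i, (D i).IsSequential) {I : Mealy α β Y} {B₀ : ℕ}
    (hB : ∀ i x a, (((D i).toMealy (hseq i)).out x a).length ≤ B₀)
    (hBI : ∀ x a, (I.out x a).length ≤ B₀)
    (hF : ∀ i x, (((D i).toMealy (hseq i)).fin x).length ≤ B₀)
    (hFI : ∀ x, (I.fin x).length ≤ B₀)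
    (hdom : ∀ u i, ((D i).toMealy (hseq i)).Acc u → I.Acc u)
    (hI : ∀ u, I.Acc u → ∃ i, ((D i).toMealy (hseq i)).Acc u ∧
      ((D i).toMealy (hseq i)).full u = I.full u)
    (t : WitnessTree n α)
    (ht : t.AtAllNodes (fun x k c => ∃ N L a b, WitnessNodeConditions D x k c N L a b)) :
    ∀ S ⊆ t.label.S, ∀ c, SameDelays (fun i => (D i).toMealy (hseq i)) t.label.u c S →
      ¬ Uncovered (fun i => (D i).toMealy (hseq i)) t.label.u S →
      ∃ B, ∀ U, ¬ Commits (fun i => (D i).toMealy (hseq i)) I S c U B := by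
  induction t with
  | node x k ch ih =>
    obtain ⟨⟨N, L, a, b, hx⟩, hch⟩ := ht
    intro S hS c hc hC
    rcases Nat.eq_zero_or_pos k with hk | hk
    · obtain ⟨w, hw, hw'⟩ := (uncovered_iff hseq).2 (hx.leaves hk)
      exact absurd ⟨w, hw, fun i hi => hw' i (hS hi)⟩ hC
    have hloop := fun i hi => (Transducer.loop_iff (hseq i)).1 (hx.loop_run i hi)
    have := Fin.pos_iff_nonempty.1 hk
    refine not_commits_step hB hBI hF hFI hdom hI (L := L) (v := x.v) ?_
      (fun i hi => (hloop i hi).2.1) (fun y => (ch y).label.S) (fun y => (ch y).label.u) ?_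
      (fun y => (hx.monotonicity y).2) ?_ (fun y => ih y (hch y)) hc hC
    · intro i hi hiL
      have hiS : i ∈ x.S := hS hi
      rw [← hx.split_union, Finset.mem_union] at hiS
      have := hx.no_run i (hiS.resolve_right hiL)
      rwa [Transducer.hasInitialRun_iff (hseq i), not_not] at this
    · intro i hi
      rw [← (hx.partition hk).2, Finset.mem_biUnion] at hi
      obtain ⟨y, -, hy⟩ := hi
      exact ⟨y, hy⟩
    · intro y z hyz i hi j hj hiL hjL
      have := hx.delays y z hyz i hi j hj
      rwa [(hloop i hiL).2.2.1, (hloop i hiL).2.2.2, (hloop j hjL).2.2.1,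
        (hloop j hjL).2.2.2] at this

end WitnessTree

theorem IsWitness.not_sequentiallyRealisable {α β : Type*} [Finite α] {n : ℕ} {Q : Fin n → Type*}
    [∀ i, Finite (Q i)] {D : ∀ i, Transducer α β (Q i)} (hseq : ∀ i, (D i).IsSequential)
    {t : WitnessTree n α} (ht : IsWitness D t) :
    ¬ SequentiallyRealisable (Transducer.disjUnion D).rel := by
  rintro ⟨P, _, I, hIseq, hdom, hsub⟩
  choose b₁ hb₁ using fun i => ((D i).toMealy (hseq i)).exists_length_out_le
  choose b₂ hb₂ using fun i => ((D i).toMealy (hseq i)).exists_length_fin_le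
  obtain ⟨b₃, hb₃⟩ := (I.toMealy hIseq).exists_length_out_le
  obtain ⟨b₄, hb₄⟩ := (I.toMealy hIseq).exists_length_fin_le
  have h1 : ∀ i, b₁ i ≤ ∑ i, b₁ i := fun i => Finset.single_le_sum_of_canonicallyOrdered
    (Finset.mem_univ i)
  have h2 : ∀ i, b₂ i ≤ ∑ i, b₂ i := fun i => Finset.single_le_sum_of_canonicallyOrdered
    (Finset.mem_univ i)
  have hC : ¬ Mealy.Uncovered (fun i => (D i).toMealy (hseq i)) t.label.u Finset.univ := by
    rintro ⟨w, ⟨j, hj⟩, hw⟩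
    exact hw j (Finset.mem_univ j) hj
  obtain ⟨B, hB⟩ := WitnessTree.not_commits hseq (I := I.toMealy hIseq)
    (B₀ := (∑ i, b₁ i) + (∑ i, b₂ i) + b₃ + b₄)
    (fun i x a => (hb₁ i x a).trans (by have := h1 i; omega))
    (fun x a => (hb₃ x a).trans (by omega))
    (fun i x => (hb₂ i x).trans (by have := h2 i; omega)) (fun x => (hb₄ x).trans (by omega))
    (fun u i hu => by
      rw [← Transducer.mem_relDom_iff, hdom, Transducer.mem_relDom_disjUnion_iff]
      exact ⟨i, (Transducer.mem_relDom_iff (hseq i)).2 hu⟩)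
    (fun u hu => by
      obtain ⟨i, hi⟩ := Transducer.mem_disjUnion_rel_iff.1
        (hsub _ _ ((Transducer.mem_rel_iff hIseq).2 ⟨hu, rfl⟩))
      obtain ⟨h, h'⟩ := (Transducer.mem_rel_iff (hseq i)).1 hi
      exact ⟨i, h, h'.symm⟩)
    t ht.2 Finset.univ ht.1.ge t.label.u ⟨fun _ _ => rfl, fun _ _ _ _ _ _ h => h⟩ hC
  -- With all machines in the set, the word of the root itself is a commitment for every bound.
  exact hB t.label.u ⟨rfl, fun _ _ => rfl, fun _ _ => rfl, fun _ _ _ _ h => h,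
    fun i hi => absurd (Finset.mem_univ i) hi⟩

/-! ### Pigeonhole arguments for weights along a run -/

/-- A walk in a finite set along which an integer weight grows in small steps to a large value
returns to some state with a different weight. -/
theorem exists_eq_and_weight_ne {X : Type*} [Finite X] (s : ℕ → X) (w : ℕ → ℤ) {m T : ℕ}
    (hm : 0 < m) (h0 : w 0 = 0) (hstep : ∀ t < T, w (t + 1) ≤ w t + m)
    (hbig : (Nat.card X * m : ℤ) ≤ w T) : ∃ a b, a < b ∧ b ≤ T ∧ s a = s b ∧ w a ≠ w b := by
  classical
  -- Steps of at most `m` cannot jump over a window of width `m`, so the first time at which `k * m`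
  -- is reached lies in the `k`-th window. There is one more window than there are states.
  have key : ∀ k : Fin (Nat.card X + 1), ∃ t ≤ T, (k * m : ℤ) ≤ w t ∧ w t < (k + 1) * m := by
    intro k
    have hk : (k * m : ℤ) ≤ w T := by
      have : ((k : ℕ) : ℤ) ≤ Nat.card X := by have := k.2; omega
      nlinarith
    have hex : ∃ t, (k * m : ℤ) ≤ w t := ⟨T, hk⟩
    refine ⟨Nat.find hex, Nat.find_min' hex hk, Nat.find_spec hex, ?_⟩
    rcases hf : Nat.find hex with _ | t
    · rw [h0]; positivity
    · have h1 := Nat.find_min hex (m := t) (by omega)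
      have h2 : Nat.find hex ≤ T := Nat.find_min' hex hk
      have h3 := hstep t (by omega)
      push Not at h1
      linarith
  choose τ hτT hτ1 hτ2 using key
  by_contra hcon
  push Not at hcon
  have hw : ∀ a b, a ≤ T → b ≤ T → s a = s b → w a = w b := by
    intro a b ha hb h
    rcases lt_trichotomy a b with hab | rfl | hab
    · exact hcon a b hab hb h
    · rfl
    · exact (hcon b a hab ha h.symm).symm
  have hinj : Function.Injective fun k => s (τ k) := by
    intro k l hkl
    have hw := hw _ _ (hτT k) (hτT l) hkl
    have h1 := hτ1 k
    have h2 := hτ2 k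
    have h3 := hτ1 l
    have h4 := hτ2 l
    rw [hw] at h1 h2
    have hm' : (0 : ℤ) < m := by exact_mod_cast hm
    have h5 : ((k : ℕ) : ℤ) < l + 1 := lt_of_mul_lt_mul_right (h1.trans_lt h4) hm'.le
    have h6 : ((l : ℕ) : ℤ) < k + 1 := lt_of_mul_lt_mul_right (h3.trans_lt h2) hm'.le
    exact Fin.ext (by omega)
  have := Nat.card_le_card_of_injective _ hinj
  simp at this

theorem exists_prefix_lt_le {α : Type*} (f : List α → ℕ) {m T : ℕ}
    (hstep : ∀ u a, f (u ++ [a]) ≤ f u + m) (h0 : f [] ≤ T + m) (z : List α) (hz : T < f z) :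
    ∃ y, y <+: z ∧ T < f y ∧ f y ≤ T + m := by
  induction z using List.reverseRecOn with
  | nil => exact ⟨[], List.prefix_rfl, hz, h0⟩
  | append_singleton u a ih =>
    by_cases hu : T < f u
    · obtain ⟨y, hy, h⟩ := ih hu
      exact ⟨y, hy.trans (List.prefix_append _ _), h⟩
    · exact ⟨u ++ [a], List.prefix_rfl, hz, (hstep u a).trans (by omega)⟩

/-! ### Bad configurations and separating loops -/

namespace Mealy

variable {ι α β : Type*} {X : ι → Type*} (M : ∀ i, Mealy α β (X i))

/-- The states reached by all machines from the states `x`. -/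
def sts (x : ∀ i, X i) (u : List α) : ∀ i, X i := fun i => (M i).st (x i) u

/-- The words obtained from words `d` by appending the outputs from the states `x` on `u`. -/
def ots (x : ∀ i, X i) (d : ι → List β) (u : List α) : ι → List β :=
  fun i => d i ++ (M i).ot (x i) u

theorem sts_append (x : ∀ i, X i) (u v : List α) :
    sts M x (u ++ v) = sts M (sts M x u) v :=
  funext fun _ => st_append _ _ _ _

theorem ots_append (x : ∀ i, X i) (d : ι → List β) (u v : List α) :
    ots M x d (u ++ v) = ots M (sts M x u) (ots M x d u) v :=
  funext fun i => by simp [ots, sts, ot_append]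

/-- From the states `x`, with past outputs `d`, a witness tree for `S` can be found. -/
inductive Bad : (∀ i, X i) → (ι → List β) → Finset ι → Prop
  | leaf {x d S} (w : List α) (j : ι) (hj : (M j).st (x j) w ∈ (M j).acc)
      (h : ∀ i ∈ S, (M i).st (x i) w ∉ (M i).acc) : Bad x d S
  | extend {x d S} (u : List α) (h : Bad (sts M x u) (ots M x d u) S) : Bad x d S
  | split {x d S} (v : List α) (r : Setoid ι) (L : Finset ι)
      (hL : ∀ i, i ∈ L ↔ i ∈ S ∧ x i ∉ (M i).dead) (hloop : ∀ i ∈ L, (M i).st (x i) v = x i)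
      (hne : ∃ i ∈ L, ∃ j ∈ L, ¬ r i j)
      (hsep : ∀ i ∈ L, ∀ j ∈ L, ¬ r i j →
        ((M i).ot (x i) v).length ≠ ((M j).ot (x j) v).length ∨
        ((M i).ot (x i) v ++ (M j).ot (x j) v ≠ [] ∧ Mismatch (d i) (d j)))
      (h : ∀ i ∈ L, ∀ A : Finset ι, (∀ j, j ∈ A ↔ j ∈ L ∧ r i j) → Bad x d A) : Bad x d S

variable {M}

/-- Past outputs enter `Bad` only through mismatches between machines of the set. In particular a
common prefix can be stripped, which lets the realiser forget what it has already emitted. -/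
theorem Bad.of_mismatch {x : ∀ i, X i} {d d' : ι → List β} {S : Finset ι} (h : Bad M x d S)
    (hd : ∀ i ∈ S, ∀ j ∈ S, ∀ s t, Mismatch (d i ++ s) (d j ++ t) →
      Mismatch (d' i ++ s) (d' j ++ t)) : Bad M x d' S := by
  induction h generalizing d' with
  | leaf w j hj h => exact .leaf w j hj h
  | extend u _ ih =>
    refine .extend u (ih fun i hi j hj s t h => ?_)
    simp only [ots, List.append_assoc] at h ⊢
    exact hd i hi j hj _ _ h
  | split v r L hL hloop hne hsep _ ih =>
    refine .split v r L hL hloop hne (fun i hi j hj hr => (hsep i hi j hj hr).imp_right fun h =>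
      ⟨h.1, ?_⟩) fun i hi A hA => ih i hi A hA fun i hi j hj =>
        hd i ((hL i).1 ((hA i).1 hi).1).1 j ((hL j).1 ((hA j).1 hj).1).1
    simpa using hd i ((hL i).1 hi).1 j ((hL j).1 hj).1 [] [] (by simpa using h.2)

theorem Bad.of_append {x : ∀ i, X i} {d e : ι → List β} {S : Finset ι} {w : List β}
    (h : Bad M x d S) (hw : ∀ i ∈ S, e i = w ++ d i) : Bad M x e S := by
  refine h.of_mismatch fun i hi j hj s t hm => ?_
  rw [hw i hi, hw j hj, List.append_assoc, List.append_assoc, mismatch_append_left_iff]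
  exact hm

/-- Dead machines never accept, and a split considers live machines only, so adding dead ones does
no harm. -/
theorem Bad.of_subset {x : ∀ i, X i} {d : ι → List β} {S S' : Finset ι} (h : Bad M x d S)
    (hS : S ⊆ S') (hdead : ∀ i ∈ S', i ∉ S → x i ∈ (M i).dead) : Bad M x d S' := by
  induction h generalizing S' with
  | @leaf x d S w j hj h =>
    refine .leaf w j hj fun i hi => ?_
    by_cases hiS : i ∈ S
    · exact h i hiS
    · exact (M i).not_mem_acc_of_mem_dead _ ((M i).st_mem_dead (hdead i hi hiS) w)
  | extend u _ ih =>
    exact .extend u (ih hS fun i hi hiS => (M i).st_mem_dead (hdead i hi hiS) u)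
  | split v r L hL hloop hne hsep h _ =>
    refine .split v r L (fun i => (hL i).trans ?_) hloop hne hsep h
    refine ⟨fun h => ⟨hS h.1, h.2⟩, fun h => ⟨?_, h.2⟩⟩
    by_contra hiS
    exact h.2 (hdead i h.1 hiS)

theorem Bad.nonempty {x : ∀ i, X i} {d : ι → List β} {S : Finset ι} (h : Bad M x d S) :
    Nonempty ι := by
  induction h with
  | leaf w j => exact ⟨j⟩
  | extend u _ ih => exact ih
  | split v r L hL hloop hne => exact ⟨hne.choose⟩

theorem exists_loop_of_weight [Finite (∀ i, X i)] (x : ∀ i, X i) (W : List α → ℤ) {m : ℕ}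
    (hm : 0 < m) (h0 : W [] = 0) (hstep : ∀ u a, W (u ++ [a]) ≤ W u + m) (z : List α)
    (hbig : (Nat.card (∀ i, X i) * m : ℤ) ≤ W z) :
    ∃ z₀ v z₁, z = z₀ ++ v ++ z₁ ∧ sts M x (z₀ ++ v) = sts M x z₀ ∧ W (z₀ ++ v) ≠ W z₀ := by
  obtain ⟨a, b, hab, hb, hs, hw⟩ := exists_eq_and_weight_ne (fun t => sts M x (z.take t))
    (fun t => W (z.take t)) (T := z.length) hm (by simpa using h0)
    (fun t ht => by rw [List.take_succ_eq_append_getElem ht]; exact hstep _ _)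
    (by simpa using hbig)
  have h1 : z.take a ++ (z.take b).drop a = z.take b := by
    have := List.take_append_drop a (z.take b)
    rwa [List.take_take, min_eq_left hab.le] at this
  refine ⟨z.take a, (z.take b).drop a, z.drop b, ?_, ?_, ?_⟩
  · rw [h1, List.take_append_drop]
  · rw [h1]; exact hs.symm
  · rw [h1]; exact hw.symm

/-- If, after small initial delays, some output exceeds the longest common prefix of all outputs
by a large amount, then the input contains a loop on which the machines can be separated. -/
theorem exists_splitting_loop [Finite (∀ i, X i)] {m : ℕ} (hm : 0 < m)
    (hB : ∀ i x a, ((M i).out x a).length ≤ m) {C : ℕ} {x : ∀ i, X i} {d : ι → List β}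
    {S : Finset ι} (hd : ∀ i ∈ S, (d i).length ≤ C) {z : List α} {p : List β}
    (hp : ∀ i ∈ S, p <+: ots M x d z i) (hmax : ∀ b, ¬ ∀ i ∈ S, p ++ [b] <+: ots M x d z i) {i : ι}
    (hi : i ∈ S)
    (hlong : p.length + (2 * (Nat.card (∀ i, X i) * m) + C + m) < (ots M x d z i).length) :
    ∃ z₀ v z₁, z = z₀ ++ v ++ z₁ ∧ sts M x (z₀ ++ v) = sts M x z₀ ∧ ∃ r : Setoid ι,
      (∃ i ∈ S, ∃ j ∈ S, ¬ r i j) ∧ ∀ i ∈ S, ∀ j ∈ S, ¬ r i j →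
        ((M i).ot (sts M x z₀ i) v).length ≠ ((M j).ot (sts M x z₀ j) v).length ∨
        ((M i).ot (sts M x z₀ i) v ++ (M j).ot (sts M x z₀ j) v ≠ [] ∧
          Mismatch (ots M x d z₀ i) (ots M x d z₀ j)) := by
  -- A loop with outputs of different lengths separates the machines by these lengths.
  by_cases hA : ∃ z₀ v z₁, z = z₀ ++ v ++ z₁ ∧ sts M x (z₀ ++ v) = sts M x z₀ ∧
      ∃ i ∈ S, ∃ j ∈ S,
        ((M i).ot (sts M x z₀ i) v).length ≠ ((M j).ot (sts M x z₀ j) v).length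
  · obtain ⟨z₀, v, z₁, hz, hs, hne⟩ := hA
    exact ⟨z₀, v, z₁, hz, hs, Setoid.ker fun i => ((M i).ot (sts M x z₀ i) v).length, hne,
      fun i _ j _ h => Or.inl h⟩
  push Not at hA
  set N := Nat.card (∀ i, X i) * m with hN
  -- Without such a loop no two output lengths drift apart by more than `N`: a larger difference
  -- would itself yield a loop that changes it.
  have hdiff : ∀ y, y <+: z → ∀ i ∈ S, ∀ j ∈ S,
      ((M i).ot (x i) y).length ≤ ((M j).ot (x j) y).length + N := by
    rintro y ⟨y', rfl⟩ i hi j hj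
    by_contra hlt
    push Not at hlt
    obtain ⟨z₀, v, z₁, hz, hs, hne⟩ := exists_loop_of_weight (M := M) x
      (fun u => (((M i).ot (x i) u).length : ℤ) - ((M j).ot (x j) u).length) hm (by simp)
      (fun u a => by
        have := hB i ((M i).st (x i) u) a
        simp only [ot_append, List.length_append, ot_cons, ot_nil, List.append_nil]
        push_cast
        omega) y (by rw [hN] at hlt; zify at hlt; linarith)
    have := hA z₀ v (z₁ ++ y') (by rw [hz]; simp) hs i hi j hj
    apply hne
    simp only [sts] at this
    simp only [ot_append, List.length_append]
    push_cast
    omega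
  have hlenx : ∀ y i, (ots M x d y i).length = (d i).length + ((M i).ot (x i) y).length := by
    intro y i
    simp [ots]
  -- The output of `i` is stopped just beyond `p.length + N + C`. By then every output of `S` is
  -- longer than `p`, while `i` still has more than `N` letters to write, enough for a loop with
  -- nonempty output.
  obtain ⟨y, ⟨y', hyy'⟩, hy1, hy2⟩ := exists_prefix_lt_le (fun u => (ots M x d u i).length)
    (m := m) (T := p.length + N + C) (fun u a => by
      have := hB i ((M i).st (x i) u) a
      simp only [ots, ot_append, List.length_append, ot_cons, ot_nil, List.append_nil]
      omega) (by have := hd i hi; simp only [hlenx, ot_nil, List.length_nil]; omega) z (by omega)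
  have hyall : ∀ j ∈ S, p.length < (ots M x d y j).length := by
    intro j hj
    have h1 := hdiff y ⟨y', hyy'⟩ i hi j hj
    have h2 := hd i hi
    simp only [hlenx] at hy1 ⊢
    omega
  obtain ⟨y₀, v, y₁, hy', hs, hne⟩ := exists_loop_of_weight (M := M) (sts M x y)
    (fun u => (((M i).ot (sts M x y i) u).length : ℤ)) hm (by simp)
    (fun u a => by
      have := hB i ((M i).st (sts M x y i) u) a
      simp only [ot_append, List.length_append, ot_cons, ot_nil, List.append_nil]
      push_cast
      omega) y' (by
        rw [← hyy', ots_append] at hlong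
        simp only [ots, List.length_append] at hlong hy2
        rw [← Nat.cast_mul, ← hN]
        simp only [sts] at hlong ⊢
        omega)
  have hz : z = y ++ y₀ ++ v ++ y₁ := by rw [← hyy', hy']; simp
  have hs' : sts M x (y ++ y₀ ++ v) = sts M x (y ++ y₀) := by
    rw [List.append_assoc, sts_append, hs, ← sts_append]
  have hb := hA _ _ _ hz hs'
  have hbi : ∀ j ∈ S, (M j).ot (sts M x (y ++ y₀) j) v ≠ [] := by
    intro j hj h0
    have h1 := hb i hi j hj
    rw [h0, sts_append] at h1
    apply hne
    simp only [sts, List.length_nil] at h1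
    simp only [ot_append, List.length_append, sts, h1, add_zero]
  have hpre : ∀ u u' j, (ots M x d u j) <+: (ots M x d (u ++ u') j) := by
    intro u u' j
    rw [ots_append]
    exact List.prefix_append _ _
  have hall : ∀ j ∈ S, p.length < (ots M x d (y ++ y₀) j).length := fun j hj =>
    (hyall j hj).trans_le (hpre _ _ _).length_le
  have hget : ∀ j (hj : j ∈ S), (ots M x d (y ++ y₀) j)[p.length]? =
      (ots M x d z j)[p.length]? := by
    intro j hj
    have h1 : ots M x d (y ++ y₀) j <+: ots M x d z j := by
      rw [hz, List.append_assoc _ v]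
      exact hpre _ _ _
    rw [List.getElem?_eq_getElem (hall j hj),
      List.getElem?_eq_getElem ((hall j hj).trans_le h1.length_le), h1.getElem]
  -- The classes are given by the letter just after `p`. A single class would contradict the
  -- maximality of `p`, and different classes mismatch at this position.
  refine ⟨y ++ y₀, v, y₁, hz, hs', Setoid.ker fun j => (ots M x d (y ++ y₀) j)[p.length]?, ?_, ?_⟩
  · by_contra hcon
    push Not at hcon
    apply hmax ((ots M x d (y ++ y₀) i)[p.length]'(hall i hi))
    intro j hj
    have h1 : (ots M x d (y ++ y₀) i)[p.length]? = (ots M x d (y ++ y₀) j)[p.length]? :=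
      hcon i hi j hj
    rw [hget j hj, List.getElem?_eq_getElem (hall i hi)] at h1
    obtain ⟨t, ht⟩ := hp j hj
    rw [← ht, List.getElem?_append_right le_rfl, Nat.sub_self] at h1
    rw [← ht, List.prefix_append_right_inj]
    cases t with
    | nil => simp at h1
    | cons c t => simp at h1; simp [h1]
  · intro j hj k hk hjk
    refine Or.inr ⟨by simp [hbi j hj], p.length, hall j hj, hall k hk, fun h => hjk ?_⟩
    change _[_]? = _[_]?
    rw [List.getElem?_eq_getElem (hall j hj), List.getElem?_eq_getElem (hall k hk), h]

/-- The classes of the separating loop are proper subsets of `S`. If all proper subsets were bad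
after `z`, then splitting at this loop would make `S` bad before it. -/
theorem exists_not_bad_of_long [Finite (∀ i, X i)] {m : ℕ} (hm : 0 < m)
    (hB : ∀ i x a, ((M i).out x a).length ≤ m) {C : ℕ} {x : ∀ i, X i} {d : ι → List β}
    {S : Finset ι} (hd : ∀ i ∈ S, (d i).length ≤ C) {z : List α} {p : List β}
    (hp : ∀ i ∈ S, p <+: ots M x d z i) (hmax : ∀ b, ¬ ∀ i ∈ S, p ++ [b] <+: ots M x d z i) {i : ι}
    (hi : i ∈ S)
    (hlong : p.length + (2 * (Nat.card (∀ i, X i) * m) + C + m) < (ots M x d z i).length)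
    (hlive : ∀ i ∈ S, sts M x z i ∉ (M i).dead) (hbad : ¬ Bad M x d S) :
    ∃ S' ⊂ S, ¬ Bad M (sts M x z) (ots M x d z) S' := by
  obtain ⟨z₀, v, z₁, rfl, hs, r, ⟨i, hi, j, hj, hij⟩, hsep⟩ :=
    exists_splitting_loop hm hB hd hp hmax hi hlong
  by_contra hcon
  push Not at hcon
  refine hbad (.extend z₀ (.split v r S (fun i => ⟨fun hi => ⟨hi, fun hdead => ?_⟩, And.left⟩)
    (fun i _ => ?_) ⟨i, hi, j, hj, hij⟩ hsep fun k hk A hA => ?_))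
  · refine hlive i hi ?_
    rw [List.append_assoc, sts_append]
    exact (M i).st_mem_dead hdead _
  · rw [sts_append] at hs
    exact congrFun hs i
  · refine .extend (v ++ z₁) ?_
    rw [← sts_append, ← ots_append, ← List.append_assoc]
    refine hcon A ((Finset.ssubset_iff_of_subset fun l hl => ((hA l).1 hl).1).2 ?_)
    by_contra hall
    push Not at hall
    exact hij (r.trans (r.symm ((hA i).1 (hall i hi)).2) ((hA j).1 (hall j hj)).2)

end Mealy

/-! ### Witness trees from bad configurations -/

namespace Mealy

variable {α β : Type*} {n : ℕ} {Q : Fin n → Type*} {D : ∀ i, Transducer α β (Q i)}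

/-- A witness tree from the data of the split at its root and subtrees for all classes. -/
theorem exists_tree_of_split (hseq : ∀ i, (D i).IsSequential) {u v : List α}
    {S L : Finset (Fin n)} (r : Setoid (Fin n))
    (hL : ∀ i, i ∈ L ↔ i ∈ S ∧ ((D i).toMealy (hseq i)).ev u ∉ ((D i).toMealy (hseq i)).dead)
    (hloop : ∀ i ∈ L, ((D i).toMealy (hseq i)).st (((D i).toMealy (hseq i)).ev u) v =
      ((D i).toMealy (hseq i)).ev u)
    (hne : ∃ i ∈ L, ∃ j ∈ L, ¬ r i j)
    (hsep : ∀ i ∈ L, ∀ j ∈ L, ¬ r i j →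
      (((D i).toMealy (hseq i)).ot (((D i).toMealy (hseq i)).ev u) v).length ≠
        (((D j).toMealy (hseq j)).ot (((D j).toMealy (hseq j)).ev u) v).length ∨
      (((D i).toMealy (hseq i)).ot (((D i).toMealy (hseq i)).ev u) v ++
        ((D j).toMealy (hseq j)).ot (((D j).toMealy (hseq j)).ev u) v ≠ [] ∧
        Mismatch (((D i).toMealy (hseq i)).o u) (((D j).toMealy (hseq j)).o u)))
    (h : ∀ i ∈ L, ∀ A : Finset (Fin n), (∀ j, j ∈ A ↔ j ∈ L ∧ r i j) → ∃ t : WitnessTree n α,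
      t.label.S = A ∧ u <+: t.label.u ∧
      t.AtAllNodes (fun x k c => ∃ N L a b, WitnessNodeConditions D x k c N L a b)) :
    ∃ t : WitnessTree n α, t.label.S = S ∧ u <+: t.label.u ∧
      t.AtAllNodes (fun x k c => ∃ N L a b, WitnessNodeConditions D x k c N L a b) := by
  classical
  obtain ⟨i₀, hi₀, j₀, hj₀, hij₀⟩ := hne
  have hLS : L ⊆ S := fun i hi => ((hL i).1 hi).1
  set P := L.image fun i => L.filter fun j => r i j with hP
  let e : Fin P.card ≃ P := P.equivFin.symm
  have hclass : ∀ y, ∃ i ∈ L, ∀ j, j ∈ (e y : Finset (Fin n)) ↔ j ∈ L ∧ r i j := by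
    intro y
    obtain ⟨i, hi, h⟩ := Finset.mem_image.1 (e y).2
    exact ⟨i, hi, fun j => by rw [← h, Finset.mem_filter]⟩
  choose g hgL hg using hclass
  choose t htS htu ht using fun y => h (g y) (hgL y) _ (hg y)
  have hPpos : 0 < P.card := Finset.card_pos.2 ⟨_, Finset.mem_image_of_mem _ hi₀⟩
  have hrel : ∀ y z, r (g y) (g z) → y = z := by
    intro y z hyz
    refine e.injective (Subtype.ext (Finset.ext fun j => ?_))
    rw [hg, hg]
    exact and_congr_right fun _ => ⟨fun hj => r.trans (r.symm hyz) hj, fun hj => r.trans hyz hj⟩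
  refine ⟨.node ⟨u, v, S, ⟨i₀, hLS hi₀⟩⟩ P.card t, rfl, List.prefix_rfl, ?_, ht⟩
  refine ⟨S \ L, L, fun i => ((D i).toMealy (hseq i)).o u,
    fun i => ((D i).toMealy (hseq i)).ot (((D i).toMealy (hseq i)).ev u) v,
    Finset.sdiff_disjoint, Finset.sdiff_union_of_subset hLS, ?_, ?_, ?_, ?_, ?_, ?_⟩
  · intro i hi
    rw [Finset.mem_sdiff, hL] at hi
    rw [Transducer.hasInitialRun_iff (hseq i), not_not]
    by_contra hd
    exact hi.2 ⟨hi.1, hd⟩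
  · intro i hi
    exact (Transducer.loop_iff (hseq i)).2 ⟨((hL i).1 hi).2, hloop i hi, rfl, rfl⟩
  · intro y
    refine ⟨?_, htu y⟩
    rw [htS, Finset.ssubset_iff_of_subset fun j hj => ((hg y j).1 hj).1]
    by_contra hall
    push Not at hall
    exact hij₀ (r.trans (r.symm ((hg y i₀).1 (hall i₀ hi₀)).2) ((hg y j₀).1 (hall j₀ hj₀)).2)
  · refine fun _ => ⟨fun y z hyz => ?_, ?_⟩
    · rw [htS, htS, Finset.disjoint_left]
      intro j hjy hjz
      exact hyz (hrel y z (r.trans ((hg y j).1 hjy).2 (r.symm ((hg z j).1 hjz).2)))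
    · ext j
      simp only [Finset.mem_biUnion, Finset.mem_univ, true_and, htS]
      refine ⟨fun ⟨y, hy⟩ => ((hg y j).1 hy).1, fun hj => ?_⟩
      refine ⟨e.symm ⟨_, Finset.mem_image_of_mem _ hj⟩, ?_⟩
      rw [Equiv.apply_symm_apply, Finset.mem_filter]
      exact ⟨hj, r.refl j⟩
  · intro y z hyz i hi j hj
    rw [htS, hg] at hi hj
    refine hsep i hi.1 j hj.1 fun hij => hyz (hrel y z ?_)
    exact r.trans hi.2 (r.trans hij (r.symm hj.2))
  · exact fun h0 => absurd h0 hPpos.ne'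

/-- An `extend` step adds no node; it only lengthens the input word of the next node. A leaf is
given the empty loop. -/
theorem Bad.exists_tree (hseq : ∀ i, (D i).IsSequential) {x : ∀ i, Option (Q i)}
    {d : Fin n → List β} {S : Finset (Fin n)} (h : Bad (fun i => (D i).toMealy (hseq i)) x d S)
    {u : List α} (hx : ∀ i, x i = ((D i).toMealy (hseq i)).ev u)
    (hd : ∀ i, d i = ((D i).toMealy (hseq i)).o u) (hS : S.Nonempty) :
    ∃ t : WitnessTree n α, t.label.S = S ∧ u <+: t.label.u ∧
      t.AtAllNodes (fun x k c => ∃ N L a b, WitnessNodeConditions D x k c N L a b) := by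
  classical
  induction h generalizing u with
  | @leaf x d S w j hj h =>
    refine ⟨.node ⟨u, [], S, hS⟩ 0 Fin.elim0, rfl, List.prefix_rfl, ?_, fun y => y.elim0⟩
    refine ⟨S.filter fun i => ¬ (D i).HasInitialRun u, S.filter fun i => (D i).HasInitialRun u,
      fun i => ((D i).toMealy (hseq i)).o u, fun _ => [],
      (Finset.disjoint_filter_filter_not S S _).symm, ?_, fun i hi => (Finset.mem_filter.1 hi).2,
      ?_, fun y => y.elim0, fun h => absurd h (lt_irrefl 0), fun y => y.elim0, fun _ => ⟨w, ?_, ?_⟩⟩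
    · rw [Finset.union_comm]
      exact Finset.filter_union_filter_not_eq _ S
    · intro i hi
      exact (Transducer.loop_iff (hseq i)).2
        ⟨(Transducer.hasInitialRun_iff (hseq i)).1 (Finset.mem_filter.1 hi).2, rfl, rfl, rfl⟩
    · rw [Transducer.mem_relDom_disjUnion_iff]
      refine ⟨j, (Transducer.mem_relDom_iff (hseq j)).2 ?_⟩
      rw [Acc, ev_append, ← hx]
      exact hj
    · intro i hi
      rw [Transducer.mem_relDom_iff (hseq i), Acc, ev_append, ← hx]
      exact h i hi
  | @extend x d S u' _ ih =>
    obtain ⟨t, htS, htu, ht⟩ := ih (u := u ++ u')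
      (fun i => by rw [ev_append, ← hx]; rfl) (fun i => by rw [o_append, ← hx, ← hd]; rfl) hS
    exact ⟨t, htS, (List.prefix_append _ _).trans htu, ht⟩
  | @split x d S v r L hL hloop hne hsep _ ih =>
    obtain rfl : x = fun i => ((D i).toMealy (hseq i)).ev u := funext hx
    obtain rfl : d = fun i => ((D i).toMealy (hseq i)).o u := funext hd
    refine exists_tree_of_split hseq r hL hloop hne hsep fun i hi A hA => ?_
    exact ih i hi A hA hx hd ⟨i, (hA i).2 ⟨hi, r.refl i⟩⟩

end Mealy

/-! ### The realiser -/

namespace Mealy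

variable {ι α β : Type*} {X : ι → Type*}

/-- A longest common prefix of the words `e i` with `i ∈ S`. -/
noncomputable def commonPrefix (S : Finset ι) (e : ι → List β) : List β :=
  open Classical in
  -- The default matters only for empty `S`; for nonempty `S` a maximal common prefix exists.
  if h : ∃ p, (∀ i ∈ S, p <+: e i) ∧ ∀ b : β, ¬ ∀ i ∈ S, p ++ [b] <+: e i then h.choose else []

theorem commonPrefix_prefix {S : Finset ι} {e : ι → List β} {i : ι} (hi : i ∈ S) :
    commonPrefix S e <+: e i := by
  rw [commonPrefix]
  split_ifs with h
  · exact h.choose_spec.1 i hi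
  · exact List.nil_prefix

theorem commonPrefix_append_drop {S : Finset ι} (e : ι → List β) {i : ι} (hi : i ∈ S) :
    commonPrefix S e ++ (e i).drop (commonPrefix S e).length = e i := by
  obtain ⟨t, ht⟩ := commonPrefix_prefix (e := e) hi
  rw [← ht, List.drop_left]

theorem not_commonPrefix_append_prefix {S : Finset ι} (hS : S.Nonempty) (e : ι → List β) (b : β) :
    ¬ ∀ i ∈ S, commonPrefix S e ++ [b] <+: e i := by
  obtain ⟨i, hi⟩ := hS
  have h : ∃ p, (∀ i ∈ S, p <+: e i) ∧ ∀ b : β, ¬ ∀ i ∈ S, p ++ [b] <+: e i := by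
    by_contra hcon
    push Not at hcon
    have : ∀ k, ∃ p, p.length = k ∧ ∀ i ∈ S, p <+: e i := by
      intro k
      induction k with
      | zero => exact ⟨[], rfl, fun _ _ => List.nil_prefix⟩
      | succ k ih =>
        obtain ⟨p, hk, hp⟩ := ih
        obtain ⟨b, hb⟩ := hcon p hp
        exact ⟨p ++ [b], by simp [hk], hb⟩
    obtain ⟨p, hk, hp⟩ := this ((e i).length + 1)
    have := (hp i hi).length_le
    omega
  rw [commonPrefix, dif_pos h]
  exact h.choose_spec.2 b

section Realiser

variable [Fintype ι] (M : ∀ i, Mealy α β (X i)) (κ : ℕ → ℕ)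

/-- States of the realiser: the states of all machines, the set of machines that are followed, and
the parts of their outputs that have not been produced yet. -/
abbrev RealiserState (β : Type*) (X : ι → Type*) := (∀ i, X i) × Finset ι × (ι → List β)

open Classical in
/-- The set of machines to follow next: the same ones as before if all of them are alive and their
delays are small, and a smaller set otherwise. -/
noncomputable def nextSet (x : ∀ i, X i) (e : ι → List β) (S : Finset ι) : Finset ι :=
  if ∀ i ∈ S, x i ∉ (M i).dead ∧
      (e i).length ≤ (commonPrefix S e).length + κ (Fintype.card ι - S.card) then S
  -- Under the invariant the last default is never taken, by `RealiserInv.exists_next`.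
  else if h : ∃ S' ⊂ S, (∀ i ∈ S', x i ∉ (M i).dead) ∧ ¬ Bad M x e S' then h.choose else ∅

open Classical in
/-- The machine that follows a set of machines and produces the common prefix of their outputs. -/
noncomputable def realiser : Mealy α β (RealiserState β X) where
  step σ a :=
    let e := ots M σ.1 σ.2.2 [a]
    let S := nextSet M κ (sts M σ.1 [a]) e σ.2.1
    (sts M σ.1 [a], S, fun i => if i ∈ S then (e i).drop (commonPrefix S e).length else [])
  out σ a :=
    let e := ots M σ.1 σ.2.2 [a]
    commonPrefix (nextSet M κ (sts M σ.1 [a]) e σ.2.1) e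
  init := (fun i => (M i).init, Finset.univ, fun _ => [])
  acc := {σ | ∃ i ∈ σ.2.1, σ.1 i ∈ (M i).acc}
  fin σ := if h : ∃ i ∈ σ.2.1, σ.1 i ∈ (M i).acc then
    σ.2.2 h.choose ++ (M h.choose).fin (σ.1 h.choose) else []
  dead := ∅
  dead_step := by simp
  not_mem_acc_of_mem_dead := by simp

/-- The invariant of the states of the realiser. -/
structure RealiserInv (C : ℕ → ℕ) (σ : RealiserState β X) : Prop where
  live : ∀ i ∈ σ.2.1, σ.1 i ∉ (M i).dead
  eq_nil : ∀ i ∉ σ.2.1, σ.2.2 i = []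
  length_le : ∀ i ∈ σ.2.1, (σ.2.2 i).length ≤ κ (Fintype.card ι - σ.2.1.card)
  -- This is a past configuration `x`, `d`, in practice that at which the present set was chosen;
  -- `z` has been read and `w` emitted since then.
  exists_past : ∃ x d z w, sts M x z = σ.1 ∧ (∀ i ∈ σ.2.1, ots M x d z i = w ++ σ.2.2 i) ∧
    (∀ i ∈ σ.2.1, (d i).length ≤ C (Fintype.card ι - σ.2.1.card)) ∧ ¬ Bad M x d σ.2.1

variable {M κ} {C : ℕ → ℕ}

theorem RealiserInv.not_bad {σ : RealiserState β X} (h : RealiserInv M κ C σ) :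
    ¬ Bad M σ.1 σ.2.2 σ.2.1 := by
  obtain ⟨x, d, z, w, hx, hd, -, hbad⟩ := h.exists_past
  intro hσ
  refine hbad (.extend z ?_)
  rw [hx]
  exact hσ.of_append hd

theorem realiser_ev (M : ∀ i, Mealy α β (X i)) (κ : ℕ → ℕ) (u : List α) :
    ((realiser M κ).ev u).1 = fun i => (M i).ev u := by
  induction u using List.reverseRecOn with
  | nil => rfl
  | append_singleton u a ih =>
    funext i
    rw [ev_append, ev_append, ← congrFun ih i]
    rfl

theorem realiser_o (M : ∀ i, Mealy α β (X i)) (κ : ℕ → ℕ) (u : List α) {i : ι}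
    (hsub : ∀ u a, ((realiser M κ).ev (u ++ [a])).2.1 ⊆ ((realiser M κ).ev u).2.1)
    (hi : i ∈ ((realiser M κ).ev u).2.1) :
    (M i).o u = (realiser M κ).o u ++ ((realiser M κ).ev u).2.2 i := by
  classical
  induction u using List.reverseRecOn with
  | nil => rfl
  | append_singleton u a ih =>
    have ih := ih (hsub u a hi)
    set σ := (realiser M κ).ev u with hσ
    have h1 : (realiser M κ).ev (u ++ [a]) = (realiser M κ).step σ a := by rw [ev_append]; rfl
    rw [h1] at hi ⊢
    have h2 : ((realiser M κ).step σ a).2.2 i =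
        (ots M σ.1 σ.2.2 [a] i).drop ((realiser M κ).out σ a).length := if_pos hi
    rw [h2, (realiser M κ).o_append, ← hσ, ot_cons, ot_nil, List.append_nil, List.append_assoc]
    have h3 : (realiser M κ).out σ a ++
        (ots M σ.1 σ.2.2 [a] i).drop ((realiser M κ).out σ a).length = ots M σ.1 σ.2.2 [a] i :=
      commonPrefix_append_drop _ hi
    rw [h3, o_append, ih, hσ, ots, realiser_ev, List.append_assoc]

theorem nextSet_subset (M : ∀ i, Mealy α β (X i)) (κ : ℕ → ℕ) (x : ∀ i, X i) (e : ι → List β)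
    (S : Finset ι) : nextSet M κ x e S ⊆ S := by
  rw [nextSet]
  split_ifs with h1 h2
  · exact subset_rfl
  · exact h2.choose_spec.1.1
  · exact Finset.empty_subset S

variable [Finite (∀ i, X i)] {m : ℕ}

/-- If a machine has died, the surviving ones form a set that is not bad. If a delay is too long,
the separating loop is sought in the input since the past configuration, whose delays are below the
smaller bound `C`. -/
theorem RealiserInv.exists_next (hm : 0 < m) (hB : ∀ i x a, ((M i).out x a).length ≤ m)
    (hκ : ∀ r, κ r = 2 * (Nat.card (∀ i, X i) * m) + C r + m)
    {σ : RealiserState β X} (h : RealiserInv M κ C σ) (a : α)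
    (hS : ¬ ∀ i ∈ σ.2.1, sts M σ.1 [a] i ∉ (M i).dead ∧ (ots M σ.1 σ.2.2 [a] i).length ≤
      (commonPrefix σ.2.1 (ots M σ.1 σ.2.2 [a])).length + κ (Fintype.card ι - σ.2.1.card)) :
    ∃ S' ⊂ σ.2.1, (∀ i ∈ S', sts M σ.1 [a] i ∉ (M i).dead) ∧
      ¬ Bad M (sts M σ.1 [a]) (ots M σ.1 σ.2.2 [a]) S' := by
  classical
  by_cases hlive : ∀ i ∈ σ.2.1, sts M σ.1 [a] i ∉ (M i).dead
  · obtain ⟨i, hi, hlong⟩ : ∃ i ∈ σ.2.1, (commonPrefix σ.2.1 (ots M σ.1 σ.2.2 [a])).length +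
        κ (Fintype.card ι - σ.2.1.card) < (ots M σ.1 σ.2.2 [a] i).length := by
      by_contra hcon
      push Not at hcon
      exact hS fun i hi => ⟨hlive i hi, hcon i hi⟩
    obtain ⟨x, d, z, w, hx, hd, hdC, hbad⟩ := h.exists_past
    have hots : ∀ i ∈ σ.2.1, ots M x d (z ++ [a]) i = w ++ ots M σ.1 σ.2.2 [a] i := by
      intro i hi
      rw [ots_append, hx]
      simp only [ots] at hd ⊢
      rw [hd i hi, List.append_assoc]
    have hsts : sts M x (z ++ [a]) = sts M σ.1 [a] := by rw [sts_append, hx]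
    obtain ⟨S', hS', hbad'⟩ := exists_not_bad_of_long hm hB hdC (z := z ++ [a])
      (p := w ++ commonPrefix σ.2.1 (ots M σ.1 σ.2.2 [a]))
      (fun i hi => by
        rw [hots i hi, List.prefix_append_right_inj]
        exact commonPrefix_prefix hi)
      (fun b hb => not_commonPrefix_append_prefix ⟨i, hi⟩ (ots M σ.1 σ.2.2 [a]) b fun j hj => by
        have := hb j hj
        rwa [hots j hj, List.append_assoc, List.prefix_append_right_inj] at this)
      hi (by
        rw [hots i hi, List.length_append, List.length_append]
        rw [hκ] at hlong
        omega)
      (by rwa [hsts]) hbad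
    refine ⟨S', hS', fun i hi => hlive i (hS'.1 hi), fun hb => hbad' ?_⟩
    rw [hsts]
    exact hb.of_append fun i hi => hots i (hS'.1 hi)
  · push Not at hlive
    obtain ⟨i, hi, hdead⟩ := hlive
    refine ⟨σ.2.1.filter fun i => sts M σ.1 [a] i ∉ (M i).dead, ?_,
      fun i hi => (Finset.mem_filter.1 hi).2, fun hb => ?_⟩
    · exact Finset.filter_ssubset.2 ⟨i, hi, not_not.2 hdead⟩
    · refine h.not_bad (.extend [a] (hb.of_subset (Finset.filter_subset _ _) fun i hi hi' => ?_))
      by_contra hl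
      exact hi' (Finset.mem_filter.2 ⟨hi, hl⟩)

/-- While the set is kept, the past configuration is kept and `z`, `w` grow. When the set shrinks,
the present configuration becomes the past one; its delays, at most `κ r + m`, fit the next bound `C
s`. -/
theorem RealiserInv.step (hm : 0 < m) (hB : ∀ i x a, ((M i).out x a).length ≤ m)
    (hκ : ∀ r, κ r = 2 * (Nat.card (∀ i, X i) * m) + C r + m)
    (hC : ∀ r s, r < s → κ r + m ≤ C s)
    {σ : RealiserState β X} (h : RealiserInv M κ C σ) (a : α) :
    RealiserInv M κ C ((realiser M κ).step σ a) := by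
  classical
  set e := ots M σ.1 σ.2.2 [a] with he
  have hstep : ∀ S, nextSet M κ (sts M σ.1 [a]) e σ.2.1 = S → (realiser M κ).step σ a =
      (sts M σ.1 [a], S, fun i => if i ∈ S then (e i).drop (commonPrefix S e).length else []) := by
    rintro S rfl
    rfl
  by_cases hS : ∀ i ∈ σ.2.1, sts M σ.1 [a] i ∉ (M i).dead ∧
      (e i).length ≤ (commonPrefix σ.2.1 e).length + κ (Fintype.card ι - σ.2.1.card)
  · rw [hstep σ.2.1 (by rw [nextSet, if_pos hS])]
    obtain ⟨x, d, z, w, hx, hd, hdC, hbad⟩ := h.exists_past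
    refine ⟨fun i hi => (hS i hi).1, fun i hi => if_neg hi, fun i hi => ?_,
      x, d, z ++ [a], w ++ commonPrefix σ.2.1 e, ?_, fun i hi => ?_, hdC, hbad⟩
    · have := (hS i hi).2
      simp only [if_pos (show i ∈ σ.2.1 from hi), List.length_drop]
      omega
    · rw [sts_append, hx]
    · simp only [if_pos (show i ∈ σ.2.1 from hi)]
      rw [List.append_assoc, commonPrefix_append_drop e hi, ots_append, hx, he]
      simp only [ots] at hd ⊢
      rw [hd i hi, List.append_assoc]
  · have hex := h.exists_next hm hB hκ a hS
    rw [hstep hex.choose (by rw [nextSet, if_neg hS, dif_pos hex])]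
    obtain ⟨hsub, hlive, hbad⟩ := hex.choose_spec
    set S' := hex.choose
    have hr : Fintype.card ι - σ.2.1.card < Fintype.card ι - S'.card := by
      have h1 := Finset.card_lt_card hsub
      have h2 := Finset.card_le_univ σ.2.1
      omega
    have hshort : ∀ i ∈ S', ((e i).drop (commonPrefix S' e).length).length ≤
        C (Fintype.card ι - S'.card) := by
      intro i hi
      have h1 := h.length_le i (hsub.1 hi)
      have h2 := hB i (σ.1 i) a
      have h3 := hC _ _ hr
      rw [List.length_drop, he]
      simp only [ots, List.length_append, ot_cons, ot_nil, List.append_nil]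
      omega
    refine ⟨hlive, fun i hi => if_neg hi, fun i hi => ?_, sts M σ.1 [a],
      fun i => if i ∈ S' then (e i).drop (commonPrefix S' e).length else [], [], [], rfl,
      fun i _ => by simp [ots], fun i hi => ?_, fun hb =>
        hbad (hb.of_append (w := commonPrefix S' e) fun i hi => ?_)⟩
    · simp only [if_pos (show i ∈ S' from hi)]
      refine (hshort i hi).trans ?_
      rw [hκ]
      omega
    · simp only [if_pos (show i ∈ S' from hi)]
      exact hshort i hi
    · simp only [if_pos (show i ∈ S' from hi)]
      exact (commonPrefix_append_drop e hi).symm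

theorem exists_realiser_of_not_bad [Finite β] (hm : 0 < m)
    (hB : ∀ i x a, ((M i).out x a).length ≤ m) (hlive : ∀ i, (M i).init ∉ (M i).dead)
    (hbad : ¬ Bad M (fun i => (M i).init) (fun _ => []) Finset.univ) :
    ∃ I : Mealy α β (RealiserState β X), (Set.range I.ev).Finite ∧
      (∀ u i, (M i).Acc u → I.Acc u) ∧
      ∀ u, I.Acc u → ∃ i, (M i).Acc u ∧ (M i).full u = I.full u := by
  classical
  -- Chosen so that `κ r + m = (r + 1) * c`, where `r` counts the machines dropped so far.
  let c := 2 * (Nat.card (∀ i, X i) * m) + 2 * m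
  let C : ℕ → ℕ := fun r => r * c
  let κ : ℕ → ℕ := fun r => 2 * (Nat.card (∀ i, X i) * m) + C r + m
  have hC : ∀ r s, r < s → κ r + m ≤ C s := by
    intro r s hrs
    have : (r + 1) * c ≤ s * c := Nat.mul_le_mul_right c hrs
    simp only [κ, C]
    rw [add_mul, one_mul] at this
    omega
  have hinv : ∀ u, RealiserInv M κ C ((realiser M κ).ev u) := by
    intro u
    induction u using List.reverseRecOn with
    | nil =>
      refine ⟨fun i _ => hlive i, fun _ _ => rfl, fun i _ => Nat.zero_le _, _, _, [], [], rfl,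
        fun i _ => rfl, fun i _ => Nat.zero_le _, hbad⟩
    | append_singleton u a ih =>
      rw [ev_append]
      exact ih.step hm hB (fun _ => rfl) hC a
  have ho := fun u i (hi : i ∈ ((realiser M κ).ev u).2.1) => realiser_o M κ u
    (fun u a => by rw [ev_append]; exact nextSet_subset M κ _ _ _) hi
  refine ⟨realiser M κ, ?_, ?_, ?_⟩
  · refine Set.Finite.subset (Set.finite_univ.prod (Set.finite_univ.prod
      (Set.Finite.pi' fun _ : ι => List.finite_length_le β (κ (Fintype.card ι))))) ?_
    rintro _ ⟨u, rfl⟩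
    refine ⟨Set.mem_univ _, Set.mem_univ _, fun i => ?_⟩
    change (_ : List β).length ≤ _
    by_cases hi : i ∈ ((realiser M κ).ev u).2.1
    · refine ((hinv u).length_le i hi).trans ?_
      have : (Fintype.card ι - ((realiser M κ).ev u).2.1.card) * c ≤ Fintype.card ι * c :=
        Nat.mul_le_mul_right c (Nat.sub_le _ _)
      exact Nat.add_le_add_right (Nat.add_le_add_left this _) _
    · rw [(hinv u).eq_nil i hi]
      exact Nat.zero_le _
  · intro u j hj
    by_contra hu
    -- If some machine accepts but no followed one does, the configuration is a leaf with empty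
    -- continuation, hence bad.
    refine (hinv u).not_bad (.leaf [] j ?_ fun i hi hacc => hu ⟨i, hi, hacc⟩)
    rw [realiser_ev]
    exact hj
  · intro u hu
    have hu' : ∃ i ∈ ((realiser M κ).ev u).2.1, ((realiser M κ).ev u).1 i ∈ (M i).acc := hu
    obtain ⟨hi, hacc⟩ := hu'.choose_spec
    set i := hu'.choose with hidef
    have hfin : (realiser M κ).fin ((realiser M κ).ev u) =
        ((realiser M κ).ev u).2.2 i ++ (M i).fin (((realiser M κ).ev u).1 i) := dif_pos hu'
    rw [realiser_ev] at hacc hfin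
    refine ⟨i, hacc, ?_⟩
    rw [full, full, hfin, ho u i hi, List.append_assoc]

end Realiser

end Mealy

theorem exists_isWitness_of_not_sequentiallyRealisable {α β : Type*} [Finite α] [Finite β] {n : ℕ}
    {Q : Fin n → Type*} [∀ i, Finite (Q i)] {D : ∀ i, Transducer α β (Q i)}
    (hseq : ∀ i, (D i).IsSequential)
    (h : ¬ SequentiallyRealisable (Transducer.disjUnion D).rel) :
    ∃ t : WitnessTree n α, IsWitness D t := by
  choose b hb using fun i => ((D i).toMealy (hseq i)).exists_length_out_le
  have hsum : ∀ i, b i ≤ ∑ i, b i := fun i => Finset.single_le_sum_of_canonicallyOrdered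
    (Finset.mem_univ i)
  by_cases hbad : Mealy.Bad (fun i => (D i).toMealy (hseq i))
      (fun i => ((D i).toMealy (hseq i)).init) (fun _ => []) Finset.univ
  · have hn : (Finset.univ : Finset (Fin n)).Nonempty := by
      exact Finset.univ_nonempty_iff.2 hbad.nonempty
    obtain ⟨t, htS, -, ht⟩ := hbad.exists_tree hseq (u := []) (fun _ => rfl) (fun _ => rfl) hn
    exact ⟨t, htS, ht⟩
  · obtain ⟨I, hfin, hdom, hI⟩ := Mealy.exists_realiser_of_not_bad (m := (∑ i, b i) + 1)
      (Nat.succ_pos _) (fun i x a => ((hb i x a).trans (hsum i)).trans (Nat.le_succ _))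
      (fun i hi => by cases hi) hbad
    refine absurd (I.sequentiallyRealisable hfin (fun u hu => ?_) fun u hu => ?_) h
    · obtain ⟨i, hi⟩ := Transducer.mem_relDom_disjUnion_iff.1 hu
      exact hdom u i ((Transducer.mem_relDom_iff (hseq i)).1 hi)
    · obtain ⟨i, hi, heq⟩ := hI u hu
      exact Transducer.mem_disjUnion_rel_iff.2
        ⟨i, (Transducer.mem_rel_iff (hseq i)).2 ⟨hi, heq.symm⟩⟩

theorem mainTheorem7 {α β : Type*} [Finite α] [Finite β] (n : ℕ) (Q : Fin n → Type*)
    [∀ i, Finite (Q i)] (D : ∀ i, Transducer α β (Q i)) (hseq : ∀ i, (D i).IsSequential)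
    (htrim : (Transducer.disjUnion D).IsTrim) :
    ¬ SequentiallyRealisable (Transducer.disjUnion D).rel ↔
      ∃ t : WitnessTree n α, IsWitness D t :=
  ⟨exists_isWitness_of_not_sequentiallyRealisable hseq,
    fun ⟨_, ht⟩ => ht.not_sequentiallyRealisable hseq⟩
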